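/- **Setting.** Let $\mu$ be Lebesgue measure on the Borel $\sigma$-algebra $\mathscr B$ of $(-1,1)$, and let $L^0$ be the space of ($\mu$-a.e. classes of) $\mathbb C$-valued measurable functions on $(-1,1)$, with the topology of convergence in measure. A *Banach function space* over $(-1,1)$ is an order ideal $X$ of $L^0$ which contains all simple functions and carries a lattice norm for which it is complete. It has the *Fatou property* if for every norm-bounded increasing sequence $0\le f_n$ in $X$ with supremum $f$ in $L^0$ one has $f\in X$ and $\|f_n\|_X\to\|f\|_X$. It is *rearrangement invariant* if it has the Fatou property and $g\in X$ whenever $g\in L^0$ and $g^*\le f^*$ for some $f\in X$, where $f^*(t)=\inf\{r\ge 0:\mu(|f|>r)\le t\}$. Its lower and upper Boyd indices are $$\underline\alpha_X=\sup_{0<t<1}\frac{\log\|E_{1/t}\|}{\log t},\qquad \overline\alpha_X=\inf_{1<t<\infty}\frac{\log\|E_{1/t}\|}{\log t},$$ where $\|E_t\|$ is the norm of the operator $E_t\colon X\to X$ with $(E_tf)(x)=f(tx)$ if $-1<tx<1$ and $(E_tf)(x)=0$ otherwise. For $f\in L^1=L^1(\mu)$ the finite Hilbert transform $T(f)\in L^0$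 is $$T(f)(t)=\lim_{\varepsilon\to0+}\frac1\pi\Big(\int_{-1}^{t-\varepsilon}+\int_{t+\varepsilon}^1\Big)\frac{f(x)}{x-t}\,dx ,$$ and $[T,X]$ is the set of all $f\in L^1$ such that $T(h)\in X$ for every $h\in L^0$ with $|h|\le|f|$ a.e. Let $m_X^0\colon\mathscr B\to L^0$ be the set function $m_X^0(A)=T(\chi_A)$. For a simple function $s=\sum_c c\,\chi_{\{s=c\}}$ put $\int_A s\,dm_X^0=\sum_c c\,m_X^0(A\cap\{s=c\})$. A measurable $f\colon(-1,1)\to\mathbb C$ is *$m_X^0$-integrable* if there are simple functions $s_n\to f$ pointwise such that $\int_A s_n\,dm_X^0$ converges in $L^0$ for every $A\in\mathscr B$; then $\int_A f\,dm_X^0$ denotes the limit. **Proposition 4.4.** Let $X$ be a rearrangement invariant space over $(-1,1)$ with $0<\underline\alpha_X\le\overline\alpha_X<1$. For every $f\in L^1$ the limit defining $T(f)(t)$ exists for a.e. $t\in(-1,1)$, and $m_X^0$ is $\sigma$-additive. Moreover: (i) Every $f\in L^1$ is $m_X^0$-integrable, the integrals $\int_A f\,dm_X^0$ do not depend on the choice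 of the sequence $(s_n)$, and $\int_A f\,dm_X^0=T(f\chi_A)$ for every $A\in\mathscr B$. (ii) If $f\in[T,X]$, then $\int_A f\,dm_X^0\in X$ for every $A\in\mathscr B$. Moreover $[T,X]$ is a linear subspace of $L^0$, $T$ restricts to a linear operator $T\colon[T,X]\to X$, and $$T(f)=\int_{-1}^1 f\,dm_X^0\in X,\qquad f\in[T,X].$$ -/

import Mathlib

open MeasureTheory Filter Set Topology
open scoped ENNReal

namespace FHT

/-- Lebesgue measure on the open interval `(-1,1)`, as a measure on `ℝ` that gives no mass to
the complement. A Borel set `A ⊆ ℝ` stands for the Borel subset `A ∩ (-1,1)` of the interval. -/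
noncomputable abbrev mu : Measure ℝ := volume.restrict (Ioo (-1 : ℝ) 1)

/-- `L⁰(-1,1)`: complex measurable functions on `(-1,1)` modulo equality almost everywhere. -/
abbrev L0 : Type := ℝ →ₘ[mu] ℂ

/-! ### Banach function spaces over `(-1,1)` -/

/-- A Banach function space over `(-1,1)`: an order ideal of `L⁰` that contains all simple
functions, with a lattice norm for which it is complete. -/
structure BanachFunctionSpace where
  carrier : Submodule ℂ L0
  norm : Seminorm ℂ carrier
  eq_zero_of_norm : ∀ f : carrier, norm f = 0 → f = 0
  mem_of_le : ∀ f ∈ carrier, ∀ g : L0, (∀ᵐ x ∂mu, ‖g x‖ ≤ ‖f x‖) → g ∈ carrier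
  norm_mono : ∀ f g : carrier,
    (∀ᵐ x ∂mu, ‖(g : L0) x‖ ≤ ‖(f : L0) x‖) → norm g ≤ norm f
  simple_mem : ∀ s : SimpleFunc ℝ ℂ, (AEEqFun.mk s s.aestronglyMeasurable : L0) ∈ carrier
  complete : ∀ u : ℕ → carrier,
    (∀ ε : ℝ, 0 < ε → ∃ N, ∀ m ≥ N, ∀ n ≥ N, norm (u m - u n) < ε) →
    ∃ f : carrier, Tendsto (fun n => norm (u n - f)) atTop (𝓝 0)

open scoped ComplexOrder in
/-- The Fatou property. The order on `ℂ` is `z ≤ w ↔ re z ≤ re w ∧ im z = im w`, and `L⁰` carries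
the almost everywhere pointwise order, so that `0 ≤ f` says that `f` is real and nonnegative. -/
def BanachFunctionSpace.HasFatou (X : BanachFunctionSpace) : Prop :=
  ∀ (u : ℕ → X.carrier) (f : L0),
    (∀ n, (0 : L0) ≤ (u n : L0)) → Monotone (fun n => (u n : L0)) →
    (∃ C : ℝ, ∀ n, X.norm (u n) ≤ C) → IsLUB (Set.range fun n => (u n : L0)) f →
    ∃ hf : f ∈ X.carrier, Tendsto (fun n => X.norm (u n)) atTop (𝓝 (X.norm ⟨f, hf⟩))

/-- The decreasing rearrangement `f*(t) = inf {r ≥ 0 : μ{|f| > r} ≤ t}`, the right continuous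
inverse of the distribution function of `f`. -/
noncomputable def rearrangement (f : L0) (t : ℝ≥0∞) : ℝ≥0∞ :=
  sInf {r : ℝ≥0∞ | mu {x | r < ‖f x‖ₑ} ≤ t}

/-- Rearrangement invariant spaces: the Fatou property holds, and `g* ≤ f*` with `f ∈ X`
implies `g ∈ X`. -/
def BanachFunctionSpace.IsRearrangementInvariant (X : BanachFunctionSpace) : Prop :=
  X.HasFatou ∧
    ∀ f ∈ X.carrier, ∀ g : L0, (∀ t, rearrangement g t ≤ rearrangement f t) → g ∈ X.carrier

/-- The dilation `E_t`: `(E_t f)(x) = f (t x)` if `-1 < t x < 1`, and `0` otherwise. -/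
noncomputable def dilation (t : ℝ) (f : L0) : L0 :=
  AEEqFun.mk (indicator {x : ℝ | t * x ∈ Ioo (-1 : ℝ) 1} fun x => f (t * x))
    (((f.stronglyMeasurable.comp_measurable (measurable_const_mul t)).indicator
      (measurableSet_Ioo.preimage (measurable_const_mul t))).aestronglyMeasurable)

open Classical in
/-- The norm of `X`, extended to `L⁰` by `∞` outside `X`. -/
noncomputable def BanachFunctionSpace.extNorm (X : BanachFunctionSpace) (f : L0) : ℝ≥0∞ :=
  if hf : f ∈ X.carrier then ENNReal.ofReal (X.norm ⟨f, hf⟩) else ∞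

/-- The operator norm of `E_t : X → X`. -/
noncomputable def BanachFunctionSpace.dilationNorm (X : BanachFunctionSpace) (t : ℝ) : ℝ≥0∞ :=
  ⨆ f : X.carrier, ⨆ _ : X.norm f ≤ 1, X.extNorm (dilation t f)

/-- The lower Boyd index `sup_{0<t<1} log ‖E_{1/t}‖ / log t`. -/
noncomputable def BanachFunctionSpace.lowerBoyd (X : BanachFunctionSpace) : EReal :=
  ⨆ t : ℝ, ⨆ _ : t ∈ Ioo (0 : ℝ) 1, ENNReal.log (X.dilationNorm (1 / t)) / (Real.log t : EReal)

/-- The upper Boyd index `inf_{1<t<∞} log ‖E_{1/t}‖ / log t`. -/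
noncomputable def BanachFunctionSpace.upperBoyd (X : BanachFunctionSpace) : EReal :=
  ⨅ t : ℝ, ⨅ _ : t ∈ Ioi (1 : ℝ), ENNReal.log (X.dilationNorm (1 / t)) / (Real.log t : EReal)

/-! ### The finite Hilbert transform -/

/-- `g` is the finite Hilbert transform of `f`: for almost every `t ∈ (-1,1)` the principal value
`lim_{ε → 0+} π⁻¹ (∫_{-1}^{t-ε} + ∫_{t+ε}^1) f(x)/(x-t) dx` exists and equals `g t`. -/
def IsFiniteHilbertTransform (f : ℝ → ℂ) (g : L0) : Prop :=
  ∀ᵐ t : ℝ ∂mu, Tendsto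
    (fun ε : ℝ => (1 / (Real.pi : ℂ)) *
      ((∫ x in (-1 : ℝ)..(t - ε), f x / ((x : ℂ) - (t : ℂ))) +
        ∫ x in (t + ε)..(1 : ℝ), f x / ((x : ℂ) - (t : ℂ))))
    (𝓝[>] 0) (𝓝 (g t))

open Classical in
/-- The finite Hilbert transform `T f ∈ L⁰` (the value `0` is used only if there is no element of
`L⁰` that is the finite Hilbert transform of `f`, which cannot happen for integrable `f`). -/
noncomputable def T (f : ℝ → ℂ) : L0 :=
  if h : ∃ g : L0, IsFiniteHilbertTransform f g then h.choose else 0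

/-- The space `[T,X]` of all `f ∈ L¹` such that `T h ∈ X` whenever `h ∈ L⁰` and `|h| ≤ |f|`
almost everywhere. -/
def optimalDomain (X : BanachFunctionSpace) : Set L0 :=
  {f | Integrable f mu ∧
    ∀ h : L0, (∀ᵐ x ∂mu, ‖h x‖ ≤ ‖f x‖) → T h ∈ X.carrier}

/-! ### Integration with respect to `L⁰`-valued set functions

Convergence in `L⁰` is convergence in measure. -/

/-- Convergence of a sequence in `L⁰` for the topology of convergence in measure. -/
def TendstoL0 (u : ℕ → L0) (g : L0) : Prop :=
  TendstoInMeasure mu (fun n => (u n : ℝ → ℂ)) atTop g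

/-- The set function `A ↦ T χ_A` with values in `L⁰`. -/
noncomputable def m0 (A : Set ℝ) : L0 := T (indicator A fun _ => (1 : ℂ))

/-- `σ`-additivity of an `L⁰`-valued set function on the Borel sets. -/
def IsL0Measure (m : Set ℝ → L0) : Prop :=
  ∀ A : ℕ → Set ℝ, (∀ n, MeasurableSet (A n)) → Pairwise (fun i j => Disjoint (A i) (A j)) →
    TendstoL0 (fun N => ∑ n ∈ Finset.range N, m (A n)) (m (⋃ n, A n))

/-- The integral `∫_A s dm` of a simple function. -/
noncomputable def simpleIntegral (m : Set ℝ → L0) (s : SimpleFunc ℝ ℂ) (A : Set ℝ) : L0 :=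
  ∑ c ∈ s.range, c • m (s ⁻¹' {c} ∩ A)

/-- `s n → f` pointwise on `(-1,1)`, and `∫_A s_n dm` converges in `L⁰` for every Borel `A`. -/
def IsDefiningSequence (m : Set ℝ → L0) (f : ℝ → ℂ) (s : ℕ → SimpleFunc ℝ ℂ) : Prop :=
  (∀ x ∈ Ioo (-1 : ℝ) 1, Tendsto (fun n => s n x) atTop (𝓝 (f x))) ∧
    ∀ A : Set ℝ, MeasurableSet A → ∃ g : L0, TendstoL0 (fun n => simpleIntegral m (s n) A) g

/-- `m`-integrability of a measurable function. -/
def IsIntegrable (m : Set ℝ → L0) (f : ℝ → ℂ) : Prop :=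
  ∃ s : ℕ → SimpleFunc ℝ ℂ, IsDefiningSequence m f s

/-- `g` is the limit of `∫_A s_n dm` for some defining sequence of `f`. -/
def HasIntegral (m : Set ℝ → L0) (f : ℝ → ℂ) (A : Set ℝ) (g : L0) : Prop :=
  ∃ s : ℕ → SimpleFunc ℝ ℂ, IsDefiningSequence m f s ∧
    TendstoL0 (fun n => simpleIntegral m (s n) A) g

open Classical in
/-- The integral `∫_A f dm` of an `m`-integrable function over a Borel set. -/
noncomputable def integral (m : Set ℝ → L0) (f : ℝ → ℂ) (A : Set ℝ) : L0 :=
  if h : ∃ g : L0, HasIntegral m f A g then h.choose else 0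

end FHT

/-! Everything rests on Kolmogorov's weak type (1,1) estimate, proved for the maximal truncations:
the set where some truncation with `0 < ε ≤ 1` exceeds `c` has measure at most a constant times
`‖f‖₁ / c`. Its source is Boole's identity. For positive point masses, `F(t) = ∑ a_p / (p - t)`
increases between consecutive poles, so up to the poles `{F > c}` lies in intervals `(y_p, p)` with
`F(y_p) = c`, and Vieta's formulas give their total length as exactly `(∑ a_p) / c`
(`sum_sub_root_eq`). If a truncated sum at `t` exceeds `c`, then at each point of `(t, t + ε)`
either `F` exceeds `c / 2` or the part of `F` from nearby masses is below `-c / 2`; Boole's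
inequality and a Vitali covering then control the maximal truncations
(`volume_exists_lt_cauchySum_filter_le`). Approximating `f dx` by point masses carries the bound to
`L¹`.

For polynomials the principal value exists at every point of the interval. Polynomials are dense in
`L¹`, so the maximal estimate gives existence almost everywhere for every integrable `f`. The weak
type bound also makes `T` continuous from `L¹` to `L⁰`. Hence `m0` is `σ`-additive, and simple
functions converging to `f` both pointwise and in `L¹` have integrals converging to `T (f χ_A)`.

An arbitrary defining sequence converges only pointwise, so the independence of the limit needs
more. Baire's theorem in the complete space of indicator functions in `L¹` yields a Vitali–Hahn–Saks
statement (`exists_uniform_l0Gauge_le`): the integrals of `s_n` and some fixed `s_k` are uniformly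
close over sets of small measure. Egorov's theorem gives uniform convergence off such a set.

Part (ii) then follows from `|f χ_A| ≤ |f|`. For linearity of `[T,X]`, a function dominated by `|f +
g|` is split in proportion to `|f|` and `|g|`. -/

namespace FHT

/-! ### Boole's inequality for finite sums of point masses -/

/-- The Cauchy transform `t ↦ ∑ a_p / (p - t)` of a finite sum of point masses. -/
noncomputable def cauchySum (S : Finset ℝ) (a : ℝ → ℝ) (t : ℝ) : ℝ :=
  ∑ p ∈ S, a p / (p - t)

theorem continuousAt_cauchySum {S : Finset ℝ} (a : ℝ → ℝ) {t : ℝ} (ht : t ∉ S) :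
    ContinuousAt (cauchySum S a) t := by
  unfold cauchySum
  refine tendsto_finsetSum _ fun p hp => ?_
  have hpt : p - t ≠ 0 := sub_ne_zero.2 fun h => ht (h ▸ hp)
  exact ContinuousAt.div₀ continuousAt_const (by fun_prop) hpt

theorem cauchySum_le_of_no_node {S : Finset ℝ} {a : ℝ → ℝ} (ha : ∀ p ∈ S, 0 ≤ a p) {s t : ℝ}
    (hst : s ≤ t) (hS : ∀ p ∈ S, p < s ∨ t < p) : cauchySum S a s ≤ cauchySum S a t := by
  refine Finset.sum_le_sum fun p hp => ?_
  rw [div_eq_mul_one_div, div_eq_mul_one_div (a p)]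
  refine mul_le_mul_of_nonneg_left ?_ (ha p hp)
  rcases hS p hp with h | h
  · exact one_div_le_one_div_of_neg_of_le (by linarith) (by linarith)
  · exact one_div_le_one_div_of_le (by linarith) (by linarith)

theorem cauchySum_eq_add_erase {S : Finset ℝ} (a : ℝ → ℝ) {p : ℝ} (hp : p ∈ S) (t : ℝ) :
    cauchySum S a t = a p / (p - t) + cauchySum (S.erase p) a t :=
  (Finset.add_sum_erase S _ hp).symm

theorem tendsto_cauchySum_left {S : Finset ℝ} {a : ℝ → ℝ} {p : ℝ} (hp : p ∈ S) (ha : 0 < a p) :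
    Tendsto (cauchySum S a) (𝓝[<] p) atTop := by
  rw [funext (cauchySum_eq_add_erase a hp)]
  refine Tendsto.atTop_add (C := cauchySum (S.erase p) a p) ?_
    ((continuousAt_cauchySum a (S.notMem_erase p)).tendsto.mono_left nhdsWithin_le_nhds)
  refine Tendsto.const_mul_atTop ha (tendsto_inv_nhdsGT_zero.comp ?_)
  refine tendsto_nhdsWithin_iff.2 ⟨?_, ?_⟩
  · have : Tendsto (fun t : ℝ => p - t) (𝓝 p) (𝓝 (p - p)) :=
      tendsto_const_nhds.sub tendsto_id
    rw [sub_self] at this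
    exact this.mono_left nhdsWithin_le_nhds
  · filter_upwards [self_mem_nhdsWithin] with t ht using sub_pos.2 (mem_Iio.1 ht)

theorem tendsto_cauchySum_right {S : Finset ℝ} {a : ℝ → ℝ} {p : ℝ} (hp : p ∈ S) (ha : 0 < a p) :
    Tendsto (cauchySum S a) (𝓝[>] p) atBot := by
  rw [funext (cauchySum_eq_add_erase a hp)]
  refine Tendsto.atBot_add (C := cauchySum (S.erase p) a p) ?_
    ((continuousAt_cauchySum a (S.notMem_erase p)).tendsto.mono_left nhdsWithin_le_nhds)
  refine Tendsto.const_mul_atBot ha (tendsto_inv_nhdsLT_zero.comp ?_)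
  refine tendsto_nhdsWithin_iff.2 ⟨?_, ?_⟩
  · have : Tendsto (fun t : ℝ => p - t) (𝓝 p) (𝓝 (p - p)) :=
      tendsto_const_nhds.sub tendsto_id
    rw [sub_self] at this
    exact this.mono_left nhdsWithin_le_nhds
  · filter_upwards [self_mem_nhdsWithin] with t ht using sub_neg.2 (mem_Ioi.1 ht)

theorem tendsto_cauchySum_atBot (S : Finset ℝ) (a : ℝ → ℝ) :
    Tendsto (cauchySum S a) atBot (𝓝 0) := by
  have : Tendsto (cauchySum S a) atBot (𝓝 (∑ p ∈ S, (0 : ℝ))) := by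
    refine tendsto_finsetSum _ fun p _ => Tendsto.const_div_atTop ?_ _
    exact tendsto_atTop_add_const_left _ _ tendsto_neg_atBot_atTop
  simpa using this

/-- On the gap just to the left of the pole `p` the sum increases to `+∞`, starting from `-∞` at the
preceding pole, or from `0` at `-∞` if `p` is the leftmost pole. The intermediate value theorem
applies because `c > 0`. The middle clause says that `[y, p)` contains no pole. -/
theorem exists_cauchySum_eq {S : Finset ℝ} {a : ℝ → ℝ} (ha : ∀ p ∈ S, 0 < a p) {c : ℝ}
    (hc : 0 < c) {p : ℝ} (hp : p ∈ S) :
    ∃ y < p, (∀ q ∈ S, q < y ∨ p ≤ q) ∧ cauchySum S a y = c := by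
  obtain ⟨s, hsp, hsS, hs⟩ : ∃ s < p, (∀ q ∈ S, q < s ∨ p ≤ q) ∧ cauchySum S a s < c := by
    by_cases hne : (S.filter (· < p)).Nonempty
    · obtain ⟨hq, hqp⟩ := Finset.mem_filter.1 ((S.filter (· < p)).max'_mem hne)
      have h1 := (tendsto_cauchySum_right hq (ha _ hq)).eventually_lt_atBot c
      obtain ⟨s, hs, hs1, hs2⟩ := (h1.and (Ioo_mem_nhdsGT hqp)).exists
      refine ⟨s, hs2, fun q hqS => ?_, hs⟩
      by_contra! h
      exact absurd ((S.filter (· < p)).le_max' q (Finset.mem_filter.2 ⟨hqS, h.2⟩)) (by linarith)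
    · have h1 := (tendsto_cauchySum_atBot S a).eventually_lt_const hc
      obtain ⟨s, hs, hs1⟩ := (h1.and (eventually_lt_atBot p)).exists
      refine ⟨s, hs1, fun q hqS => ?_, hs⟩
      by_contra! h
      exact hne ⟨q, Finset.mem_filter.2 ⟨hqS, h.2⟩⟩
  obtain ⟨r, hr, hsr, hrp⟩ := (((tendsto_cauchySum_left hp (ha p hp)).eventually_gt_atTop c).and
    (Ioo_mem_nhdsLT hsp)).exists
  have hcont : ContinuousOn (cauchySum S a) (Icc s r) := fun t ht => by
    refine (continuousAt_cauchySum a fun h => ?_).continuousWithinAt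
    rcases hsS t h with h' | h' <;> linarith [ht.1, ht.2]
  obtain ⟨y, hy, hyc⟩ := intermediate_value_Icc hsr.le hcont ⟨hs.le, hr.le⟩
  refine ⟨y, by linarith [hy.2], fun q hq => ?_, hyc⟩
  rcases hsS q hq with h | h
  · exact Or.inl (by linarith [hy.1])
  · exact Or.inr h

open Polynomial in
/-- The sum of the lengths of the intervals on which a Cauchy sum exceeds `c`. -/
theorem sum_sub_root_eq {S : Finset ℝ} {a y : ℝ → ℝ} {c : ℝ} (ha : ∀ p ∈ S, a p ≠ 0) (hc : 0 < c)
    (hyS : ∀ p ∈ S, y p ∉ S) (hy : Set.InjOn y S) (hyc : ∀ p ∈ S, cauchySum S a (y p) = c) :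
    ∑ p ∈ S, (p - y p) = (∑ p ∈ S, a p) / c := by
  rcases S.eq_empty_or_nonempty with rfl | hne
  · simp
  have hcard : 0 < S.card := hne.card_pos
  set N : ℝ[X] := ∏ p ∈ S, (X - C p) with hN
  set Q : ℝ[X] := ∑ p ∈ S, C (a p) * ∏ q ∈ S.erase p, (X - C q) with hQ
  set R : ℝ[X] := ∏ p ∈ S, (X - C (y p)) with hR
  have hNm : N.Monic := monic_prod_of_monic _ _ fun p _ => monic_X_sub_C p
  have hRm : R.Monic := monic_prod_of_monic _ _ fun p _ => monic_X_sub_C _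
  have hNd : N.natDegree = S.card := natDegree_finsetProd_X_sub_C_eq_card S id
  have hRd : R.natDegree = S.card := by
    rw [hR, natDegree_prod_of_monic _ _ fun p _ => monic_X_sub_C _]; simp
  have hEm : ∀ p ∈ S, (∏ q ∈ S.erase p, (X - C q) : ℝ[X]).Monic := fun p _ =>
    monic_prod_of_monic _ _ fun p _ => monic_X_sub_C _
  have hEd : ∀ p ∈ S, (∏ q ∈ S.erase p, (X - C q) : ℝ[X]).natDegree = S.card - 1 := fun p hp => by
    rw [natDegree_prod_of_monic _ _ fun p _ => monic_X_sub_C _]; simp [Finset.card_erase_of_mem hp]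
  have hQc : Q.coeff (S.card - 1) = ∑ p ∈ S, a p := by
    rw [hQ, finsetSum_coeff]
    refine Finset.sum_congr rfl fun p hp => ?_
    rw [coeff_C_mul, ← hEd p hp, (hEm p hp).coeff_natDegree, mul_one]
  have hQd : Q.degree < S.card := by
    refine (degree_sum_le _ _).trans_lt ?_
    refine (Finset.sup_lt_iff (by simp)).2 fun p hp => ?_
    rw [degree_C_mul (ha p hp), degree_eq_natDegree (hEm p hp).ne_zero, hEd p hp]
    exact_mod_cast Nat.sub_lt hcard one_pos
  have hNR : (N - R).degree < S.card := by
    have := degree_sub_lt_left (p := N) (q := R)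
      (by rw [degree_eq_natDegree hNm.ne_zero, degree_eq_natDegree hRm.ne_zero, hNd, hRd])
      hNm.ne_zero (by rw [hNm.leadingCoeff, hRm.leadingCoeff])
    rwa [degree_eq_natDegree hNm.ne_zero, hNd] at this
  -- Since the Cauchy sum equals `-Q / N` off the nodes, `c N + Q` vanishes at every `y p`.
  -- Subtracting `c R`, which vanishes there too, cancels the leading term, leaving degree below
  -- `S.card` with `S.card` distinct zeros.
  have heq : C c * (N - R) + Q = 0 := by
    refine eq_zero_of_degree_lt_of_eval_finset_eq_zero (S.image y) ?_ ?_
    · rw [Finset.card_image_of_injOn hy]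
      exact (degree_add_le _ _).trans_lt (max_lt ((degree_C_mul hc.ne').trans_lt hNR) hQd)
    · intro t ht
      obtain ⟨p, hp, rfl⟩ := Finset.mem_image.1 ht
      have h0 : ∀ q ∈ S, y p - q ≠ 0 := fun q hq => sub_ne_zero.2 fun h => hyS p hp (h ▸ hq)
      have hR0 : R.eval (y p) = 0 := by
        rw [hR, eval_prod]; exact Finset.prod_eq_zero hp (by simp)
      have hQ0 : Q.eval (y p) = - c * N.eval (y p) := by
        rw [← hyc p hp, hQ, hN, eval_finsetSum, cauchySum, neg_mul, Finset.sum_mul,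
          ← Finset.sum_neg_distrib]
        refine Finset.sum_congr rfl fun q hq => ?_
        rw [eval_mul, eval_C, eval_prod, eval_prod, ← Finset.mul_prod_erase S _ hq]
        have := h0 q hq
        have h' : q - y p ≠ 0 := fun h => this (by linarith)
        simp only [eval_sub, eval_X, eval_C]
        rw [← neg_sub q (y p)]
        field_simp
      rw [eval_add, eval_mul, eval_sub, hR0, hQ0, eval_C]; ring
  -- Vieta: the coefficients just below the top are minus the sums of the roots of `N` and `R`, and
  -- the total mass for `Q`.
  have hco := congrArg (fun P : ℝ[X] => P.coeff (S.card - 1)) heq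
  have hNc : N.coeff (S.card - 1) = - ∑ p ∈ S, p := by
    simpa using prod_X_sub_C_coeff_card_pred S id hcard
  have hRc : R.coeff (S.card - 1) = - ∑ p ∈ S, y p := prod_X_sub_C_coeff_card_pred S y hcard
  simp only [coeff_add, coeff_C_mul, coeff_sub, hNc, hRc, hQc, coeff_zero] at hco
  rw [Finset.sum_sub_distrib, eq_div_iff hc.ne']
  linarith

/-- A point `t` off the nodes with a large sum must have a pole on its right. If `p` is the nearest
one, monotonicity on the gap before `p` forces `t > y p`. So the intervals `(y p, p)` cover, and
`sum_sub_root_eq` gives their total length. -/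
theorem volume_lt_cauchySum_le_of_pos {S : Finset ℝ} {a : ℝ → ℝ} (ha : ∀ p ∈ S, 0 < a p) {c : ℝ}
    (hc : 0 < c) :
    volume {t | c < cauchySum S a t} ≤ ENNReal.ofReal ((∑ p ∈ S, a p) / c) := by
  choose! y hyp hyS hyc using fun p (hp : p ∈ S) => exists_cauchySum_eq ha hc hp
  have hyS' : ∀ p ∈ S, y p ∉ S := fun p hp h => by
    rcases hyS p hp _ h with h' | h' <;> linarith [hyp p hp]
  have hinj : Set.InjOn y S := by
    intro p hp q hq h
    rcases lt_trichotomy p q with hlt | rfl | hlt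
    · rcases hyS q hq p hp with h' | h' <;> linarith [hyp p hp]
    · rfl
    · rcases hyS p hp q hq with h' | h' <;> linarith [hyp q hq]
  have hsub : {t | c < cauchySum S a t} ⊆ (S : Set ℝ) ∪ ⋃ p ∈ S, Ioo (y p) p := by
    intro t ht
    by_cases htS : t ∈ S
    · exact Or.inl htS
    right
    have hne : (S.filter (t < ·)).Nonempty := by
      by_contra hne
      have : cauchySum S a t ≤ 0 := by
        refine Finset.sum_nonpos fun p hp => div_nonpos_of_nonneg_of_nonpos (ha p hp).le ?_
        by_contra! h
        exact hne ⟨p, Finset.mem_filter.2 ⟨hp, by linarith⟩⟩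
      exact absurd ht (by simp only [mem_ofPred_eq]; linarith)
    obtain ⟨hp, htp⟩ := Finset.mem_filter.1 ((S.filter (t < ·)).min'_mem hne)
    set p := (S.filter (t < ·)).min' hne
    refine mem_iUnion₂.2 ⟨p, hp, ?_, htp⟩
    by_contra! h
    have := cauchySum_le_of_no_node (fun p hp => (ha p hp).le) h fun q hq => by
      rcases lt_trichotomy q t with h' | h' | h'
      · exact Or.inl h'
      · exact absurd (h' ▸ hq) htS
      · exact Or.inr ((hyp p hp).trans_le
          ((S.filter (t < ·)).min'_le q (Finset.mem_filter.2 ⟨hq, h'⟩)))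
    rw [hyc p hp] at this
    exact absurd ht (not_lt.2 this)
  calc volume {t | c < cauchySum S a t}
      ≤ volume (S : Set ℝ) + volume (⋃ p ∈ S, Ioo (y p) p) :=
        (measure_mono hsub).trans (measure_union_le _ _)
    _ ≤ 0 + ∑ p ∈ S, ENNReal.ofReal (p - y p) := by
        refine add_le_add (S.finite_toSet.measure_zero _).le ?_
        refine (measure_biUnion_finset_le _ _).trans (Finset.sum_le_sum fun p _ => ?_)
        rw [Real.volume_Ioo]
    _ = ENNReal.ofReal ((∑ p ∈ S, a p) / c) := by
        rw [zero_add, ← ENNReal.ofReal_sum_of_nonneg, sum_sub_root_eq (fun p hp => (ha p hp).ne') hc hyS' hinj hyc]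
        exact fun p hp => by linarith [hyp p hp]

/-- Boole's inequality for positive finite sums of point masses. -/
theorem volume_lt_cauchySum_le {S : Finset ℝ} {a : ℝ → ℝ} (ha : ∀ p ∈ S, 0 ≤ a p) {c : ℝ}
    (hc : 0 < c) :
    volume {t | c < cauchySum S a t} ≤ ENNReal.ofReal ((∑ p ∈ S, a p) / c) := by
  classical
  -- Nodes of weight zero are not poles and are dropped.
  have h := volume_lt_cauchySum_le_of_pos (S := S.filter (a · ≠ 0)) (a := a)
    (fun p hp => by
      obtain ⟨h1, h2⟩ := Finset.mem_filter.1 hp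
      exact lt_of_le_of_ne (ha p h1) (Ne.symm h2)) hc
  rw [Finset.sum_filter_ne_zero] at h
  have heq : cauchySum (S.filter (a · ≠ 0)) a = cauchySum S a := funext fun t =>
    Finset.sum_filter_of_ne fun p _ hp hp' => hp (by rw [hp', zero_div])
  rwa [heq] at h

theorem cauchySum_image_neg (S : Finset ℝ) (a : ℝ → ℝ) (t : ℝ) :
    cauchySum (S.image Neg.neg) (fun p => a (-p)) t = -cauchySum S a (-t) := by
  rw [cauchySum, Finset.sum_image neg_injective.injOn, cauchySum, ← Finset.sum_neg_distrib]
  refine Finset.sum_congr rfl fun p _ => ?_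
  rw [neg_neg, ← div_neg]; congr 1; ring

theorem volume_cauchySum_lt_neg_le {S : Finset ℝ} {a : ℝ → ℝ} (ha : ∀ p ∈ S, 0 ≤ a p) {c : ℝ}
    (hc : 0 < c) :
    volume {t | cauchySum S a t < -c} ≤ ENNReal.ofReal ((∑ p ∈ S, a p) / c) := by
  have h := volume_lt_cauchySum_le (S := S.image Neg.neg) (a := fun p => a (-p))
    (fun p hp => by
      obtain ⟨q, hq, rfl⟩ := Finset.mem_image.1 hp
      simpa using ha q hq) hc
  rw [Finset.sum_image neg_injective.injOn] at h
  simp only [neg_neg] at h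
  convert h using 1
  rw [← Measure.measure_neg]
  congr 1
  ext t
  simp only [Set.mem_neg, mem_ofPred_eq, cauchySum_image_neg]
  exact lt_neg

theorem measurable_cauchySum (S : Finset ℝ) (a : ℝ → ℝ) : Measurable (cauchySum S a) := by
  unfold cauchySum
  fun_prop

/-! ### Maximal truncations of Cauchy sums -/

/-- Off a ball `[t - ε, t + ε]` the Cauchy sum increases, so that a large truncated sum at `t`
forces the full sum or the local sum to be large on `(t, t + ε)`. -/
theorem ofReal_radius_le {S : Finset ℝ} {a : ℝ → ℝ} (ha : ∀ p ∈ S, 0 ≤ a p) {c : ℝ}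
    (hc : 0 < c) {t ε : ℝ} (h : c < cauchySum (S.filter (ε < |· - t|)) a t) :
    ENNReal.ofReal ε ≤ volume ({s | c / 2 < cauchySum S a s} ∩ Ioo t (t + ε)) +
      ENNReal.ofReal ((∑ p ∈ S.filter (|· - t| ≤ ε), a p) / (c / 2)) := by
  have hsub : Ioo t (t + ε) ⊆ ({s | c / 2 < cauchySum S a s} ∩ Ioo t (t + ε)) ∪
      {s | cauchySum (S.filter (|· - t| ≤ ε)) a s < -(c / 2)} := by
    intro s hs
    by_cases h2 : cauchySum (S.filter (|· - t| ≤ ε)) a s < -(c / 2)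
    · exact Or.inr h2
    refine Or.inl ⟨?_, hs⟩
    -- The far part has no node in `[t, s]`, so it increases from `t` to `s` and still exceeds `c`
    -- at `s`.
    have h3 : cauchySum (S.filter (ε < |· - t|)) a t ≤ cauchySum (S.filter (ε < |· - t|)) a s := by
      refine cauchySum_le_of_no_node (fun p hp => ha p (Finset.mem_filter.1 hp).1) hs.1.le
        fun p hp => ?_
      rcases lt_abs.1 (Finset.mem_filter.1 hp).2 with h | h
      · right; linarith [hs.2]
      · left; linarith [hs.1, hs.2]
    have h4 : cauchySum S a s = cauchySum (S.filter (|· - t| ≤ ε)) a s +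
        cauchySum (S.filter (ε < |· - t|)) a s := by
      simp only [← not_le]
      exact (Finset.sum_filter_add_sum_filter_not S _ _).symm
    simp only [mem_ofPred_eq]
    linarith
  calc ENNReal.ofReal ε = volume (Ioo t (t + ε)) := by rw [Real.volume_Ioo]; simp
    _ ≤ _ := (measure_mono hsub).trans (measure_union_le _ _)
    _ ≤ _ := by
      gcongr
      exact volume_cauchySum_lt_neg_le (fun p hp => ha p (Finset.mem_filter.1 hp).1) (half_pos hc)

/-- Disjointness lets both terms of `ofReal_radius_le` be summed: the pieces of the superlevel set
are disjoint, and each point mass is close to at most one centre. Each sum is at most `2 / c` times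
the total mass. -/
theorem sum_ofReal_radius_le {S : Finset ℝ} {a : ℝ → ℝ} (ha : ∀ p ∈ S, 0 ≤ a p) {c : ℝ}
    (hc : 0 < c) (F : Finset (ℝ × ℝ))
    (hF : ∀ b ∈ F, c < cauchySum (S.filter (b.2 < |· - b.1|)) a b.1)
    (hdisj : (F : Set (ℝ × ℝ)).PairwiseDisjoint fun b => Metric.closedBall b.1 b.2) :
    ∑ b ∈ F, ENNReal.ofReal b.2 ≤ ENNReal.ofReal (4 * (∑ p ∈ S, a p) / c) := by
  classical
  have h1 : ∑ b ∈ F, volume ({s | c / 2 < cauchySum S a s} ∩ Ioo b.1 (b.1 + b.2)) ≤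
      ENNReal.ofReal ((∑ p ∈ S, a p) / (c / 2)) := by
    rw [← measure_biUnion_finset]
    · refine (measure_mono ?_).trans (volume_lt_cauchySum_le ha (half_pos hc))
      exact iUnion₂_subset fun b _ => inter_subset_left
    · refine hdisj.mono fun b => inter_subset_right.trans fun s hs => ?_
      rw [Metric.mem_closedBall, Real.dist_eq, abs_le]
      constructor <;> linarith [hs.1, hs.2]
    · exact fun b _ => (measurableSet_lt measurable_const (measurable_cauchySum S a)).inter
        measurableSet_Ioo
  have h2 : ∑ b ∈ F, ENNReal.ofReal ((∑ p ∈ S.filter (|· - b.1| ≤ b.2), a p) / (c / 2)) ≤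
      ENNReal.ofReal ((∑ p ∈ S, a p) / (c / 2)) := by
    rw [← ENNReal.ofReal_sum_of_nonneg fun b _ => div_nonneg
      (Finset.sum_nonneg fun p hp => ha p (Finset.mem_filter.1 hp).1) (half_pos hc).le,
      ← Finset.sum_div]
    refine ENNReal.ofReal_le_ofReal (div_le_div_of_nonneg_right ?_ (half_pos hc).le)
    rw [← Finset.sum_biUnion]
    · refine Finset.sum_le_sum_of_subset_of_nonneg ?_ fun p hp _ => ha p hp
      exact Finset.biUnion_subset.2 fun b _ => Finset.filter_subset _ _
    · intro b hb b' hb' hne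
      rw [Function.onFun, Finset.disjoint_left]
      intro p hp hp'
      have hball := Set.disjoint_left.1 (hdisj hb hb' hne)
      exact hball (Finset.mem_filter.1 hp).2 (Finset.mem_filter.1 hp').2
  calc ∑ b ∈ F, ENNReal.ofReal b.2
      ≤ _ := Finset.sum_le_sum fun b hb => ofReal_radius_le ha hc (hF b hb)
    _ ≤ ENNReal.ofReal ((∑ p ∈ S, a p) / (c / 2)) + ENNReal.ofReal ((∑ p ∈ S, a p) / (c / 2)) := by
      rw [Finset.sum_add_distrib]; exact add_le_add h1 h2
    _ = _ := by
      have : 0 ≤ (∑ p ∈ S, a p) / (c / 2) := div_nonneg (Finset.sum_nonneg ha) (half_pos hc).le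
      rw [← ENNReal.ofReal_add this this]
      congr 1; field_simp; ring

/-- Weak type estimate for the maximal truncated Cauchy sums. -/
theorem volume_exists_lt_cauchySum_filter_le {S : Finset ℝ} {a : ℝ → ℝ} (ha : ∀ p ∈ S, 0 ≤ a p)
    {c : ℝ} (hc : 0 < c) :
    volume {t | ∃ ε ∈ Ioc (0 : ℝ) 1, c < cauchySum (S.filter (ε < |· - t|)) a t} ≤
      ENNReal.ofReal (40 * (∑ p ∈ S, a p) / c) := by
  -- Vitali's lemma needs bounded radii, which is why `ε ≤ 1` is imposed. Enlarging by `5` gives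
  -- intervals of length `10` times the radius, hence the constant `10 * 4 = 40`.
  obtain ⟨u, hu, hdisj, hcov⟩ := Vitali.exists_disjoint_subfamily_covering_enlargement_closedBall
    {b : ℝ × ℝ | b.2 ∈ Ioc (0 : ℝ) 1 ∧ c < cauchySum (S.filter (b.2 < |· - b.1|)) a b.1}
    Prod.fst Prod.snd 1 (fun b hb => hb.1.2) 5 (by norm_num)
  have hcount : u.Countable := hdisj.countable_of_nonempty_interior fun b hb =>
    ⟨b.1, Metric.ball_subset_interior_closedBall (Metric.mem_ball_self (hu hb).1.1)⟩
  have hsub : {t | ∃ ε ∈ Ioc (0 : ℝ) 1, c < cauchySum (S.filter (ε < |· - t|)) a t} ⊆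
      ⋃ b ∈ u, Metric.closedBall b.1 (5 * b.2) := by
    rintro t ⟨ε, hε, ht⟩
    obtain ⟨b, hb, hsub⟩ := hcov (t, ε) ⟨hε, ht⟩
    exact mem_iUnion₂.2 ⟨b, hb, hsub (Metric.mem_closedBall_self hε.1.le)⟩
  calc _ ≤ ∑' b : u, volume (Metric.closedBall b.1.1 (5 * b.1.2)) :=
        (measure_mono hsub).trans (measure_biUnion_le _ hcount _)
    _ = ∑' b : u, ENNReal.ofReal 10 * ENNReal.ofReal b.1.2 := by
        refine tsum_congr fun b => ?_
        rw [Real.volume_closedBall, ← ENNReal.ofReal_mul (by norm_num)]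
        congr 1; ring
    _ ≤ ENNReal.ofReal 10 * ENNReal.ofReal (4 * (∑ p ∈ S, a p) / c) := by
        rw [ENNReal.tsum_mul_left]
        gcongr
        rw [ENNReal.tsum_eq_iSup_sum]
        refine iSup_le fun F => ?_
        have := sum_ofReal_radius_le ha hc (F.map (Function.Embedding.subtype _))
          (fun b hb => by
            obtain ⟨b', -, rfl⟩ := Finset.mem_map.1 hb
            exact (hu b'.2).2)
          (hdisj.subset fun b hb => by
            obtain ⟨b', -, rfl⟩ := Finset.mem_map.1 (Finset.mem_coe.1 hb)
            exact b'.2)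
        simpa using this
    _ = _ := by
        rw [← ENNReal.ofReal_mul (by norm_num)]
        congr 1; ring

theorem volume_exists_cauchySum_filter_lt_neg_le {S : Finset ℝ} {a : ℝ → ℝ}
    (ha : ∀ p ∈ S, 0 ≤ a p) {c : ℝ} (hc : 0 < c) :
    volume {t | ∃ ε ∈ Ioc (0 : ℝ) 1, cauchySum (S.filter (ε < |· - t|)) a t < -c} ≤
      ENNReal.ofReal (40 * (∑ p ∈ S, a p) / c) := by
  have h := volume_exists_lt_cauchySum_filter_le (S := S.image Neg.neg) (a := fun p => a (-p))
    (fun p hp => by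
      obtain ⟨q, hq, rfl⟩ := Finset.mem_image.1 hp
      simpa using ha q hq) hc
  rw [Finset.sum_image neg_injective.injOn] at h
  simp only [neg_neg] at h
  convert h using 1
  rw [← Measure.measure_neg]
  congr 1
  ext t
  simp only [Set.mem_neg, mem_ofPred_eq]
  refine exists_congr fun ε => and_congr_right fun _ => ?_
  rw [Finset.filter_image, cauchySum_image_neg, lt_neg]
  simp only [sub_neg_eq_add, ← neg_add', abs_neg]

/-! ### From point masses to integrable densities -/

variable {E : Type*} [NormedAddCommGroup E] [NormedSpace ℝ E]

/-- The truncated Cauchy kernel. -/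
noncomputable def truncKernel (ε t x : ℝ) : ℝ := if ε < |x - t| then (x - t)⁻¹ else 0

/-- The truncated Hilbert transform, without the factor `π⁻¹`. -/
noncomputable def truncHilbert (f : ℝ → E) (ε t : ℝ) : E := ∫ x, truncKernel ε t x • f x ∂mu

theorem measurable_truncKernel_uncurry (ε : ℝ) :
    Measurable fun z : ℝ × ℝ => truncKernel ε z.1 z.2 := by
  unfold truncKernel
  exact Measurable.ite (measurableSet_lt (by fun_prop) (by fun_prop)) (by fun_prop) (by fun_prop)

theorem measurable_truncKernel (ε t : ℝ) : Measurable (truncKernel ε t) :=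
  (measurable_truncKernel_uncurry ε).comp (measurable_const.prodMk measurable_id)

theorem abs_truncKernel_le {ε : ℝ} (hε : 0 < ε) (t x : ℝ) : |truncKernel ε t x| ≤ ε⁻¹ := by
  unfold truncKernel
  split_ifs with h
  · rw [abs_inv]
    exact inv_anti₀ hε h.le
  · simpa using hε.le

theorem continuousAt_truncKernel {ε : ℝ} (hε : 0 < ε) {t x : ℝ} (hx : |x - t| ≠ ε) :
    ContinuousAt (truncKernel ε t) x := by
  have hc : ContinuousAt (fun y : ℝ => |y - t|) x := by fun_prop
  rcases lt_or_gt_of_ne hx with h | h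
  · refine (continuousAt_const (y := (0 : ℝ))).congr ?_
    filter_upwards [hc.eventually_lt_const h] with y hy
    rw [truncKernel, if_neg hy.not_gt]
  · have hne : x - t ≠ 0 := fun h0 => by rw [h0, abs_zero] at h; linarith
    refine (ContinuousAt.inv₀ (f := fun y : ℝ => y - t) (by fun_prop) hne).congr ?_
    filter_upwards [hc.eventually_const_lt h] with y hy
    rw [truncKernel, if_pos hy, Pi.inv_apply]

theorem integrable_truncKernel_smul {f : ℝ → E} (hf : Integrable f mu) {ε : ℝ} (hε : 0 < ε)
    (t : ℝ) : Integrable (fun x => truncKernel ε t x • f x) mu :=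
  hf.bdd_smul ε⁻¹ (measurable_truncKernel ε t).aestronglyMeasurable
    (Eventually.of_forall fun x => abs_truncKernel_le hε t x)

theorem integral_simpleFunc_comp_mul {f : ℝ → ℝ} (hf : Integrable f mu) (φ : SimpleFunc ℝ ℝ)
    (k : ℝ → ℝ) :
    ∫ x, k (φ x) * f x ∂mu = ∑ p ∈ φ.range, k p * ∫ x in φ ⁻¹' {p}, f x ∂mu := by
  have h1 : ∀ x, k (φ x) * f x = ∑ p ∈ φ.range, (φ ⁻¹' {p}).indicator (fun x => k p * f x) x := by
    intro x
    rw [Finset.sum_eq_single (φ x)]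
    · simp
    · intro p _ hp
      exact indicator_of_notMem (fun h => hp (mem_singleton_iff.1 (mem_preimage.1 h)).symm) _
    · exact fun h => absurd (φ.mem_range_self x) h
  simp_rw [h1]
  rw [integral_finsetSum]
  · refine Finset.sum_congr rfl fun p _ => ?_
    rw [integral_indicator (φ.measurableSet_preimage _), integral_const_mul]
  · exact fun p _ => (hf.const_mul _).indicator (φ.measurableSet_preimage _)

/-- Fatou's lemma for sets, without measurability: continuity from below along increasing unions
holds for arbitrary sets. This suits maximal sets, which are uncountable unions over `ε`. -/
theorem measure_le_of_eventually_mem {α : Type*} [MeasurableSpace α] {μ : Measure α} {s : Set α}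
    {u : ℕ → Set α} {b : ℝ≥0∞} (hs : ∀ x ∈ s, ∀ᶠ n in atTop, x ∈ u n) (hu : ∀ n, μ (u n) ≤ b) :
    μ s ≤ b := by
  have hsub : s ⊆ ⋃ N, ⋂ n ≥ N, u n := fun x hx => by
    obtain ⟨N, hN⟩ := eventually_atTop.1 (hs x hx)
    exact mem_iUnion.2 ⟨N, mem_iInter₂.2 hN⟩
  have hmono : Monotone fun N => ⋂ n ≥ N, u n := fun N M h =>
    biInter_subset_biInter_left fun n hn => h.trans hn
  refine (measure_mono hsub).trans ?_
  rw [hmono.measure_iUnion]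
  exact iSup_le fun N => (measure_mono (biInter_subset_of_mem (le_refl N))).trans (hu N)

/-- Simple functions `φ n` approximate the identity, and the mass of `f` on each fibre of `φ n` is
placed at the value of `φ n` there. The truncated Cauchy sum is then the integral of `truncKernel ε
t (φ n x) * f x`. It converges by domination by `ε⁻¹ * ‖f x‖`, the kernel being discontinuous only
at the two points `t ± ε`. -/
theorem exists_discretization {f : ℝ → ℝ} (hf : Integrable f mu) (h0 : ∀ x, 0 ≤ f x) :
    ∃ (S : ℕ → Finset ℝ) (a : ℕ → ℝ → ℝ), (∀ n p, 0 ≤ a n p) ∧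
      (∀ n, ∑ p ∈ S n, a n p = ∫ x, f x ∂mu) ∧
      ∀ ε > 0, ∀ t, Tendsto (fun n => cauchySum ((S n).filter (ε < |· - t|)) (a n) t) atTop
        (𝓝 (truncHilbert f ε t)) := by
  set φ : ℕ → SimpleFunc ℝ ℝ := fun n => SimpleFunc.approxOn id measurable_id univ 0 (mem_univ _) n
  refine ⟨fun n => (φ n).range, fun n p => ∫ x in φ n ⁻¹' {p}, f x ∂mu,
    fun n p => integral_nonneg h0, fun n => ?_, fun ε hε t => ?_⟩
  · simpa using (integral_simpleFunc_comp_mul hf (φ n) fun _ => 1).symm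
  · have h1 : ∀ n, cauchySum ((φ n).range.filter (ε < |· - t|))
        (fun p => ∫ x in φ n ⁻¹' {p}, f x ∂mu) t = ∫ x, truncKernel ε t (φ n x) * f x ∂mu := by
      intro n
      rw [integral_simpleFunc_comp_mul hf, cauchySum, Finset.sum_filter]
      refine Finset.sum_congr rfl fun p _ => ?_
      unfold truncKernel
      split_ifs
      · rw [div_eq_inv_mul]
      · rw [zero_mul]
    simp_rw [h1]
    refine tendsto_integral_of_dominated_convergence (fun x => ε⁻¹ * ‖f x‖) (fun n => ?_)
      (hf.norm.const_mul _) (fun n => Eventually.of_forall fun x => ?_) ?_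
    · exact ((measurable_truncKernel ε t).comp (φ n).measurable).aestronglyMeasurable.mul hf.1
    · rw [norm_mul]
      exact mul_le_mul_of_nonneg_right (abs_truncKernel_le hε t _) (norm_nonneg _)
    · have hnull : ∀ᵐ x ∂mu, x ∉ ({t + ε, t - ε} : Set ℝ) :=
        measure_eq_zero_iff_ae_notMem.1 (((toFinite _).measure_zero _))
      filter_upwards [hnull] with x hx
      have hx' : |x - t| ≠ ε := fun h => hx <| by
        rcases eq_or_eq_neg_of_abs_eq h with h | h
        · exact Or.inl (by linarith)
        · exact Or.inr (mem_singleton_iff.2 (by linarith))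
      have hφ : Tendsto (fun n => φ n x) atTop (𝓝 x) :=
        SimpleFunc.tendsto_approxOn measurable_id (mem_univ _) (by simp)
      exact ((continuousAt_truncKernel hε hx').tendsto.comp hφ).mul_const _

theorem volume_exists_lt_abs_truncHilbert_le_of_nonneg {f : ℝ → ℝ} (hf : Integrable f mu)
    (h0 : ∀ x, 0 ≤ f x) {c : ℝ} (hc : 0 < c) :
    volume {t | ∃ ε ∈ Ioc (0 : ℝ) 1, c < |truncHilbert f ε t|} ≤
      ENNReal.ofReal (80 * (∫ x, f x ∂mu) / c) := by
  obtain ⟨S, a, ha, hsum, hlim⟩ := exists_discretization hf h0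
  have h1 := measure_le_of_eventually_mem (μ := volume)
    (s := {t | ∃ ε ∈ Ioc (0 : ℝ) 1, c < truncHilbert f ε t})
    (u := fun n => {t | ∃ ε ∈ Ioc (0 : ℝ) 1, c < cauchySum ((S n).filter (ε < |· - t|)) (a n) t})
    (fun t ⟨ε, hε, ht⟩ => ((hlim ε hε.1 t).eventually_const_lt ht).mono fun n hn => ⟨ε, hε, hn⟩)
    (fun n => (volume_exists_lt_cauchySum_filter_le (fun p _ => ha n p) hc).trans_eq
      (by rw [hsum n]))
  have h2 := measure_le_of_eventually_mem (μ := volume)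
    (s := {t | ∃ ε ∈ Ioc (0 : ℝ) 1, truncHilbert f ε t < -c})
    (u := fun n => {t | ∃ ε ∈ Ioc (0 : ℝ) 1, cauchySum ((S n).filter (ε < |· - t|)) (a n) t < -c})
    (fun t ⟨ε, hε, ht⟩ => ((hlim ε hε.1 t).eventually_lt_const ht).mono fun n hn => ⟨ε, hε, hn⟩)
    (fun n => (volume_exists_cauchySum_filter_lt_neg_le (fun p _ => ha n p) hc).trans_eq
      (by rw [hsum n]))
  have hnn : 0 ≤ 40 * (∫ x, f x ∂mu) / c :=
    div_nonneg (mul_nonneg (by norm_num) (integral_nonneg h0)) hc.le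
  refine ((measure_mono ?_).trans (measure_union_le _ _)).trans
    ((add_le_add h1 h2).trans_eq ?_)
  · rintro t ⟨ε, hε, ht⟩
    rcases lt_abs.1 ht with h | h
    · exact Or.inl ⟨ε, hε, h⟩
    · exact Or.inr ⟨ε, hε, by linarith⟩
  · rw [← ENNReal.ofReal_add hnn hnn]; congr 1; ring

theorem truncHilbert_sub {f g : ℝ → E} (hf : Integrable f mu) (hg : Integrable g mu) {ε : ℝ}
    (hε : 0 < ε) (t : ℝ) :
    truncHilbert (fun x => f x - g x) ε t = truncHilbert f ε t - truncHilbert g ε t := by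
  simp only [truncHilbert, smul_sub]
  exact integral_sub (integrable_truncKernel_smul hf hε t) (integrable_truncKernel_smul hg hε t)

theorem volume_exists_lt_abs_truncHilbert_le {f : ℝ → ℝ} (hf : Integrable f mu)
    {c : ℝ} (hc : 0 < c) :
    volume {t | ∃ ε ∈ Ioc (0 : ℝ) 1, c < |truncHilbert f ε t|} ≤
      ENNReal.ofReal (320 * (∫ x, ‖f x‖ ∂mu) / c) := by
  have bound : ∀ g : ℝ → ℝ, Integrable g mu → (∀ x, 0 ≤ g x) → (∀ x, g x ≤ ‖f x‖) →
      volume {t | ∃ ε ∈ Ioc (0 : ℝ) 1, c / 2 < |truncHilbert g ε t|} ≤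
      ENNReal.ofReal (160 * (∫ x, ‖f x‖ ∂mu) / c) := fun g hg h0 hle => by
    refine (volume_exists_lt_abs_truncHilbert_le_of_nonneg hg h0 (half_pos hc)).trans
      (ENNReal.ofReal_le_ofReal ?_)
    have := integral_mono hg hf.norm hle
    calc _ = 160 * (∫ x, g x ∂mu) / c := by field_simp; ring
      _ ≤ _ := by gcongr
  have h1 := bound _ hf.pos_part (fun x => le_max_right _ _)
    fun x => max_le (le_abs_self _) (abs_nonneg _)
  have h2 := bound _ hf.neg_part (fun x => le_max_right _ _)
    fun x => max_le (neg_le_abs _) (abs_nonneg _)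
  have hnn : 0 ≤ 160 * (∫ x, ‖f x‖ ∂mu) / c :=
    div_nonneg (mul_nonneg (by norm_num) (integral_nonneg fun _ => norm_nonneg _)) hc.le
  -- A truncation exceeding `c` forces that of the positive or of the negative part to exceed `c /
  -- 2`; halving the level and adding two sets turns `80` into `320`.
  refine ((measure_mono ?_).trans (measure_union_le _ _)).trans
    ((add_le_add h1 h2).trans_eq ?_)
  · rintro t ⟨ε, hε, ht⟩
    have heq : f = fun x => max (f x) 0 - max (-f x) 0 := funext fun x => by
      rcases le_total 0 (f x) with h | h
      · rw [max_eq_left h, max_eq_right (by linarith), sub_zero]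
      · rw [max_eq_right h, max_eq_left (by linarith)]; ring
    rw [heq, truncHilbert_sub hf.pos_part hf.neg_part hε.1] at ht
    by_contra! h
    simp only [mem_union, mem_ofPred_eq, not_or, not_exists, not_and, not_lt] at h
    linarith [abs_sub (truncHilbert (fun x => max (f x) 0) ε t)
      (truncHilbert (fun x => max (-f x) 0) ε t), h.1 ε hε, h.2 ε hε]
  · rw [← ENNReal.ofReal_add hnn hnn]; congr 1; ring

theorem re_truncHilbert {f : ℝ → ℂ} (hf : Integrable f mu) {ε : ℝ} (hε : 0 < ε) (t : ℝ) :
    (truncHilbert f ε t).re = truncHilbert (fun x => (f x).re) ε t := by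
  rw [truncHilbert, ← Complex.reCLM_apply,
    ← ContinuousLinearMap.integral_comp_comm _ (integrable_truncKernel_smul hf hε t)]
  simp [truncHilbert]

theorem im_truncHilbert {f : ℝ → ℂ} (hf : Integrable f mu) {ε : ℝ} (hε : 0 < ε) (t : ℝ) :
    (truncHilbert f ε t).im = truncHilbert (fun x => (f x).im) ε t := by
  rw [truncHilbert, ← Complex.imCLM_apply,
    ← ContinuousLinearMap.integral_comp_comm _ (integrable_truncKernel_smul hf hε t)]
  simp [truncHilbert]

/-- Weak type `(1,1)` of the maximal truncated Hilbert transform. -/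
theorem volume_exists_lt_norm_truncHilbert_le {f : ℝ → ℂ} (hf : Integrable f mu)
    {c : ℝ} (hc : 0 < c) :
    volume {t | ∃ ε ∈ Ioc (0 : ℝ) 1, c < ‖truncHilbert f ε t‖} ≤
      ENNReal.ofReal (1280 * (∫ x, ‖f x‖ ∂mu) / c) := by
  have bound : ∀ g : ℝ → ℝ, Integrable g mu → (∀ x, ‖g x‖ ≤ ‖f x‖) →
      volume {t | ∃ ε ∈ Ioc (0 : ℝ) 1, c / 2 < |truncHilbert g ε t|} ≤
      ENNReal.ofReal (640 * (∫ x, ‖f x‖ ∂mu) / c) := fun g hg hle => by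
    refine (volume_exists_lt_abs_truncHilbert_le hg (half_pos hc)).trans
      (ENNReal.ofReal_le_ofReal ?_)
    have := integral_mono hg.norm hf.norm hle
    calc _ = 640 * (∫ x, ‖g x‖ ∂mu) / c := by field_simp; ring
      _ ≤ _ := by gcongr
  have h1 := bound _ hf.re fun x => Complex.abs_re_le_norm (f x)
  have h2 := bound _ hf.im fun x => Complex.abs_im_le_norm (f x)
  have hnn : 0 ≤ 640 * (∫ x, ‖f x‖ ∂mu) / c :=
    div_nonneg (mul_nonneg (by norm_num) (integral_nonneg fun _ => norm_nonneg _)) hc.le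
  refine ((measure_mono ?_).trans (measure_union_le _ _)).trans
    ((add_le_add h1 h2).trans_eq ?_)
  · rintro t ⟨ε, hε, ht⟩
    have h3 := Complex.norm_le_abs_re_add_abs_im (truncHilbert f ε t)
    rw [re_truncHilbert hf hε.1, im_truncHilbert hf hε.1] at h3
    by_contra! h
    simp only [mem_union, mem_ofPred_eq, not_or, not_exists, not_and, not_lt] at h
    have h4 := h.1 ε hε
    have h5 := h.2 ε hε
    simp only [RCLike.re_eq_complex_re, RCLike.im_eq_complex_im] at h4 h5
    linarith
  · rw [← ENNReal.ofReal_add hnn hnn]; congr 1; ring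

/-! ### Almost everywhere existence of the principal value -/

theorem truncHilbert_eq_intervalIntegral {f : ℝ → E} (hf : Integrable f mu) {t : ℝ}
    {ε : ℝ} (hε : 0 < ε) (h1 : -1 < t - ε) (h2 : t + ε < 1) :
    truncHilbert f ε t = (∫ x in (-1 : ℝ)..(t - ε), (x - t)⁻¹ • f x) +
      ∫ x in (t + ε)..(1 : ℝ), (x - t)⁻¹ • f x := by
  have hA : MeasurableSet {x : ℝ | ε < |x - t|} := measurableSet_lt (by fun_prop) (by fun_prop)
  have hind : (fun x => truncKernel ε t x • f x) =
      indicator {x : ℝ | ε < |x - t|} fun x => (x - t)⁻¹ • f x := funext fun x => by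
    by_cases hx : ε < |x - t|
    · rw [indicator_of_mem (by exact hx), truncKernel, if_pos hx]
    · rw [indicator_of_notMem (by exact hx), truncKernel, if_neg hx, zero_smul]
  have hset : {x : ℝ | ε < |x - t|} ∩ Ioo (-1) 1 = Ioo (-1) (t - ε) ∪ Ioo (t + ε) 1 := by
    ext x
    simp only [mem_inter_iff, mem_ofPred_eq, lt_abs, mem_Ioo, mem_union]
    constructor
    · rintro ⟨h | h, h3⟩
      · right; constructor <;> linarith
      · left; constructor <;> linarith
    · rintro (h | h)
      · exact ⟨Or.inr (by linarith), h.1, by linarith⟩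
      · exact ⟨Or.inl (by linarith), by linarith, h.2⟩
  have hint := integrable_truncKernel_smul hf hε t
  rw [hind, integrable_indicator_iff hA, IntegrableOn, Measure.restrict_restrict hA, hset] at hint
  rw [truncHilbert, hind, integral_indicator hA, Measure.restrict_restrict hA, hset,
    setIntegral_union _ measurableSet_Ioo (IntegrableOn.mono_set hint subset_union_left)
      (IntegrableOn.mono_set hint subset_union_right),
    intervalIntegral.integral_of_le h1.le, intervalIntegral.integral_of_le h2.le,
    integral_Ioc_eq_integral_Ioo, integral_Ioc_eq_integral_Ioo]
  rw [Set.disjoint_left]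
  intro x hx hx'
  linarith [hx.2, hx'.1]

theorem eventually_small {t : ℝ} (ht : t ∈ Ioo (-1 : ℝ) 1) :
    ∀ᶠ ε in 𝓝[>] (0 : ℝ), 0 < ε ∧ ε ≤ 1 ∧ -1 < t - ε ∧ t + ε < 1 := by
  have hr : 0 < min (t + 1) (1 - t) := lt_min (by linarith [ht.1]) (by linarith [ht.2])
  filter_upwards [Ioo_mem_nhdsGT hr, Ioo_mem_nhdsGT one_pos] with ε hε hε'
  have h1 := lt_min_iff.1 hε.2
  exact ⟨hε.1, hε'.2.le, by linarith, by linarith⟩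

/-- The truncation is symmetric about `t`, so the two `log ε` terms cancel and the truncated
integral is constant for small `ε`. -/
theorem tendsto_truncHilbert_const {t : ℝ} (ht : t ∈ Ioo (-1 : ℝ) 1) (b : ℝ) :
    ∃ l, Tendsto (fun ε => truncHilbert (fun _ => b) ε t) (𝓝[>] 0) (𝓝 l) := by
  refine ⟨(Real.log (1 - t) - Real.log (1 + t)) * b, tendsto_const_nhds.congr' ?_⟩
  filter_upwards [eventually_small ht] with ε ⟨hε, _, h1, h2⟩
  rw [truncHilbert_eq_intervalIntegral (integrable_const b) hε h1 h2]
  simp only [smul_eq_mul, intervalIntegral.integral_mul_const]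
  rw [intervalIntegral.integral_comp_sub_right (fun x => x⁻¹),
    intervalIntegral.integral_comp_sub_right (fun x => x⁻¹),
    integral_inv_of_neg (by linarith [ht.1]) (by linarith),
    integral_inv_of_pos (by linarith) (by linarith [ht.2]),
    Real.log_div (by linarith) (by linarith [ht.1]), Real.log_div (by linarith [ht.2]) (by linarith),
    show t - ε - t = -ε by ring, show -1 - t = -(1 + t) by ring, show t + ε - t = ε by ring,
    Real.log_neg_eq_log, Real.log_neg_eq_log]
  ring

theorem integrable_of_continuous {F : Type*} [NormedAddCommGroup F] {f : ℝ → F} (hf : Continuous f) : Integrable f mu :=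
  (hf.integrableOn_Icc (a := -1) (b := 1)).mono_set Ioo_subset_Icc_self

theorem tendsto_truncHilbert_sub_mul {t : ℝ} {q : ℝ → ℝ} (hq : Integrable q mu) :
    Tendsto (fun ε => truncHilbert (fun x => (x - t) * q x) ε t) (𝓝[>] 0) (𝓝 (∫ x, q x ∂mu)) := by
  refine tendsto_integral_filter_of_dominated_convergence (fun x => ‖q x‖) ?_ ?_ hq.norm ?_
  · refine Eventually.of_forall fun ε => ?_
    exact (measurable_truncKernel ε t).aestronglyMeasurable.smul
      ((show Measurable fun x : ℝ => x - t by fun_prop).aestronglyMeasurable.mul hq.1)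
  · refine Eventually.of_forall fun ε => Eventually.of_forall fun x => ?_
    unfold truncKernel
    split_ifs
    · by_cases h : x - t = 0
      · simp [h]
      · simp [h]
    · simp
  · have hnull : ∀ᵐ x ∂mu, x ∉ ({t} : Set ℝ) :=
      measure_eq_zero_iff_ae_notMem.1 ((toFinite _).measure_zero _)
    filter_upwards [hnull] with x hx
    have hne : x - t ≠ 0 := sub_ne_zero.2 hx
    refine tendsto_const_nhds.congr' ?_
    filter_upwards [Ioo_mem_nhdsGT (abs_pos.2 hne)] with ε hε
    rw [truncKernel, if_pos hε.2, smul_eq_mul, inv_mul_cancel_left₀ hne]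

theorem truncHilbert_add {f g : ℝ → E} (hf : Integrable f mu) (hg : Integrable g mu) {ε : ℝ}
    (hε : 0 < ε) (t : ℝ) :
    truncHilbert (fun x => f x + g x) ε t = truncHilbert f ε t + truncHilbert g ε t := by
  simp only [truncHilbert, smul_add]
  exact integral_add (integrable_truncKernel_smul hf hε t) (integrable_truncKernel_smul hg hε t)

open Polynomial in
-- Write `p(x) = (x - t) q(x) + p(t)`. The first term cancels the singularity, and the second is a
-- constant.
theorem tendsto_truncHilbert_polynomial (p : ℝ[X]) {t : ℝ} (ht : t ∈ Ioo (-1 : ℝ) 1) :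
    ∃ l, Tendsto (fun ε => truncHilbert (fun x => p.eval x) ε t) (𝓝[>] 0) (𝓝 l) := by
  obtain ⟨q, hq⟩ := X_sub_C_dvd_sub_C_eval (a := t) (p := p)
  have hev : ∀ x, p.eval x = (x - t) * q.eval x + p.eval t := fun x => by
    have := congrArg (Polynomial.eval x) hq
    simp only [eval_sub, eval_C, eval_mul, eval_X] at this
    linarith
  obtain ⟨l, hl⟩ := tendsto_truncHilbert_const ht (p.eval t)
  refine ⟨_, ((tendsto_truncHilbert_sub_mul (t := t)
    (integrable_of_continuous q.continuous)).add hl).congr' ?_⟩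
  filter_upwards [self_mem_nhdsWithin] with ε hε
  rw [← truncHilbert_add (integrable_of_continuous (by fun_prop)) (integrable_const _) hε]
  congr 1
  exact funext fun x => (hev x).symm

open Polynomial in
theorem exists_polynomial_integral_sub_le {f : ℝ → ℝ} (hf : Integrable f mu) {d : ℝ} (hd : 0 < d) :
    ∃ p : ℝ[X], ∫ x, ‖f x - p.eval x‖ ∂mu ≤ d := by
  obtain ⟨g, hg, hgi⟩ := hf.exists_boundedContinuous_integral_sub_le (half_pos hd)
  -- Weierstrass on `[-1, 1]`; the interval has length `2`, so a uniform error `d / 4` costs `d / 2`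
  -- in `L¹`.
  obtain ⟨p, hp⟩ := exists_polynomial_near_of_continuousOn (-1) 1 g g.continuous.continuousOn
    (d / 4) (by linarith)
  have hpi : Integrable (fun x => p.eval x) mu := integrable_of_continuous p.continuous
  refine ⟨p, ?_⟩
  have h1 : ∫ x, ‖g x - p.eval x‖ ∂mu ≤ d / 2 := by
    have : ∀ᵐ x ∂mu, ‖g x - p.eval x‖ ≤ d / 4 := by
      filter_upwards [ae_restrict_mem measurableSet_Ioo] with x hx
      rw [norm_sub_rev]
      exact (hp x (Ioo_subset_Icc_self hx)).le
    refine (integral_mono_ae (hgi.sub hpi).norm (integrable_const _) this).trans_eq ?_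
    rw [integral_const, measureReal_restrict_apply_univ, Real.volume_real_Ioo_of_le (by norm_num)]
    simp; ring
  calc ∫ x, ‖f x - p.eval x‖ ∂mu ≤ ∫ x, (‖f x - g x‖ + ‖g x - p.eval x‖) ∂mu :=
        integral_mono (hf.sub hpi).norm ((hf.sub hgi).norm.add (hgi.sub hpi).norm)
          fun x => norm_sub_le_norm_sub_add_norm_sub _ _ _
    _ = _ := integral_add (hf.sub hgi).norm (hgi.sub hpi).norm
    _ ≤ d := by linarith

/-- Subtracting a polynomial within `d` of `f` in `L¹` does not affect convergence, and the maximal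
estimate bounds the exceptional set by `320 * d / η`. The set does not depend on `d`, so `d → 0`
makes it null. -/
theorem ae_exists_small_oscillation {f : ℝ → ℝ} (hf : Integrable f mu) {η : ℝ} (hη : 0 < η) :
    ∀ᵐ t ∂mu, ∃ l, ∀ᶠ ε in 𝓝[>] 0, |truncHilbert f ε t - l| < 2 * η := by
  set B := {t | ¬ ∃ l, ∀ᶠ ε in 𝓝[>] 0, |truncHilbert f ε t - l| < 2 * η} with hB
  have key : ∀ d : ℝ, 0 < d → mu B ≤ ENNReal.ofReal (320 * d / η) := fun d hd => by
    obtain ⟨p, hp⟩ := exists_polynomial_integral_sub_le hf hd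
    have hpi : Integrable (fun x => p.eval x) mu := integrable_of_continuous p.continuous
    have hsub : B ∩ Ioo (-1) 1 ⊆
        {t | ∃ ε ∈ Ioc (0 : ℝ) 1, η < |truncHilbert (fun x => f x - p.eval x) ε t|} := by
      rintro t ⟨htB, ht⟩
      by_contra hcon
      refine htB ?_
      obtain ⟨l, hl⟩ := tendsto_truncHilbert_polynomial p ht
      refine ⟨l, ?_⟩
      filter_upwards [eventually_small ht, Metric.tendsto_nhds.1 hl η hη] with ε ⟨hε, hε1, _⟩ h2
      have h3 : |truncHilbert (fun x => f x - p.eval x) ε t| ≤ η := by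
        by_contra! h
        exact hcon ⟨ε, ⟨hε, hε1⟩, h⟩
      rw [truncHilbert_sub hf hpi hε] at h3
      rw [Real.dist_eq] at h2
      have := abs_sub_le (truncHilbert f ε t) (truncHilbert (fun x => p.eval x) ε t) l
      linarith
    calc mu B = volume (B ∩ Ioo (-1) 1) := Measure.restrict_apply' measurableSet_Ioo
      _ ≤ _ := measure_mono hsub
      _ ≤ _ := volume_exists_lt_abs_truncHilbert_le (hf.sub hpi) hη
      _ ≤ _ := ENNReal.ofReal_le_ofReal (by gcongr; exact hp)
  change mu B = 0
  refine le_antisymm (ge_of_tendsto (f := fun d => ENNReal.ofReal (320 * d / η))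
    (x := 𝓝[>] (0 : ℝ)) ?_ (by filter_upwards [self_mem_nhdsWithin] with d hd using key d hd)) bot_le
  have : Tendsto (fun d : ℝ => ENNReal.ofReal (320 * d / η)) (𝓝 0)
      (𝓝 (ENNReal.ofReal (320 * 0 / η))) :=
    (ENNReal.continuous_ofReal.comp (by fun_prop : Continuous fun d : ℝ => 320 * d / η)).tendsto 0
  simpa using this.mono_left nhdsWithin_le_nhds

theorem ae_exists_tendsto_truncHilbert_real {f : ℝ → ℝ} (hf : Integrable f mu) :
    ∀ᵐ t ∂mu, ∃ l, Tendsto (fun ε => truncHilbert f ε t) (𝓝[>] 0) (𝓝 l) := by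
  have := ae_all_iff.2 fun k : ℕ =>
    ae_exists_small_oscillation hf (η := 1 / ((k : ℝ) + 1)) (by positivity)
  filter_upwards [this] with t ht
  refine cauchy_map_iff_exists_tendsto.1 (Metric.cauchy_iff.2 ⟨inferInstance, fun r hr => ?_⟩)
  obtain ⟨k, hk⟩ := exists_nat_one_div_lt (show 0 < r / 4 by linarith)
  obtain ⟨l, hl⟩ := ht k
  refine ⟨_, image_mem_map hl, ?_⟩
  rintro _ ⟨ε, hε, rfl⟩ _ ⟨δ, hδ, rfl⟩
  simp only [mem_ofPred_eq] at hε hδ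
  have := dist_triangle_right (truncHilbert f ε t) (truncHilbert f δ t) l
  rw [Real.dist_eq _ l, Real.dist_eq _ l] at this
  linarith

theorem ae_exists_tendsto_truncHilbert {f : ℝ → ℂ} (hf : Integrable f mu) :
    ∀ᵐ t ∂mu, ∃ l, Tendsto (fun ε => truncHilbert f ε t) (𝓝[>] 0) (𝓝 l) := by
  filter_upwards [ae_exists_tendsto_truncHilbert_real hf.re,
    ae_exists_tendsto_truncHilbert_real hf.im] with t ⟨l₁, h₁⟩ ⟨l₂, h₂⟩
  refine ⟨(l₁ : ℂ) + l₂ * Complex.I, ((((Complex.continuous_ofReal.tendsto _).comp h₁)).add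
    (((Complex.continuous_ofReal.tendsto _).comp h₂).mul_const _)).congr' ?_⟩
  filter_upwards [self_mem_nhdsWithin] with ε hε
  refine Eq.trans ?_ (Complex.re_add_im _)
  rw [re_truncHilbert hf hε, im_truncHilbert hf hε]
  rfl

/-! ### The finite Hilbert transform on `L¹` -/

theorem isFiniteHilbertTransform_iff {f : ℝ → ℂ} (hf : Integrable f mu) {g : L0} :
    IsFiniteHilbertTransform f g ↔ ∀ᵐ t ∂mu,
      Tendsto (fun ε => (1 / (Real.pi : ℂ)) * truncHilbert f ε t) (𝓝[>] 0) (𝓝 (g t)) := by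
  refine eventually_congr ?_
  filter_upwards [ae_restrict_mem measurableSet_Ioo] with t ht
  refine tendsto_congr' ?_
  filter_upwards [eventually_small ht] with ε ⟨hε, _, h1, h2⟩
  rw [truncHilbert_eq_intervalIntegral hf hε h1 h2]
  have : ∀ x : ℝ, f x / ((x : ℂ) - (t : ℂ)) = (x - t)⁻¹ • f x := fun x => by
    rw [Complex.real_smul, Complex.ofReal_inv, Complex.ofReal_sub, div_eq_inv_mul]
  simp only [this]

theorem aestronglyMeasurable_truncHilbert {f : ℝ → ℂ} (hf : Integrable f mu) (ε : ℝ) :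
    AEStronglyMeasurable (truncHilbert f ε) mu := by
  have : AEStronglyMeasurable (fun z : ℝ × ℝ => truncKernel ε z.1 z.2 • f z.2) (mu.prod mu) :=
    (measurable_truncKernel_uncurry ε).aestronglyMeasurable.smul hf.1.comp_snd
  exact this.integral_prod_right'

theorem exists_isFiniteHilbertTransform {f : ℝ → ℂ} (hf : Integrable f mu) :
    ∃ g : L0, IsFiniteHilbertTransform f g := by
  -- A sequence of truncation radii produces a measurable limit, which must agree with the full
  -- limit wherever that exists.
  have hseq : Tendsto (fun n : ℕ => 1 / ((n : ℝ) + 1)) atTop (𝓝[>] 0) :=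
    tendsto_nhdsWithin_iff.2 ⟨tendsto_one_div_add_atTop_nhds_zero_nat,
      Eventually.of_forall fun n => mem_Ioi.2 (by positivity)⟩
  obtain ⟨g, hgm, hg⟩ := exists_stronglyMeasurable_limit_of_tendsto_ae (μ := mu)
    (f := fun (n : ℕ) t => (1 / (Real.pi : ℂ)) * truncHilbert f (1 / ((n : ℝ) + 1)) t)
    (fun n => (aestronglyMeasurable_truncHilbert hf _).const_mul _) (by
      filter_upwards [ae_exists_tendsto_truncHilbert hf] with t ⟨l, hl⟩
      exact ⟨_, (hl.comp hseq).const_mul _⟩)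
  refine ⟨AEEqFun.mk g hgm.aestronglyMeasurable, (isFiniteHilbertTransform_iff hf).2 ?_⟩
  filter_upwards [ae_exists_tendsto_truncHilbert hf, hg,
    AEEqFun.coeFn_mk g hgm.aestronglyMeasurable] with t ⟨l, hl⟩ hgt hmk
  rw [hmk, ← tendsto_nhds_unique ((hl.comp hseq).const_mul _) hgt]
  exact hl.const_mul _

theorem isFiniteHilbertTransform_T {f : ℝ → ℂ} (hf : Integrable f mu) :
    IsFiniteHilbertTransform f (T f) := by
  have h := exists_isFiniteHilbertTransform hf
  rw [T, dif_pos h]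
  exact h.choose_spec

theorem IsFiniteHilbertTransform.T_eq {f : ℝ → ℂ} {g : L0} (h : IsFiniteHilbertTransform f g) :
    T f = g := by
  have hex : ∃ g : L0, IsFiniteHilbertTransform f g := ⟨g, h⟩
  have hT : IsFiniteHilbertTransform f (T f) := by
    rw [T, dif_pos hex]
    exact hex.choose_spec
  refine AEEqFun.ext ?_
  filter_upwards [h, hT] with t h1 h2 using tendsto_nhds_unique h2 h1

theorem tendsto_truncHilbert_T {f : ℝ → ℂ} (hf : Integrable f mu) :
    ∀ᵐ t ∂mu, Tendsto (fun ε => (1 / (Real.pi : ℂ)) * truncHilbert f ε t) (𝓝[>] 0)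
      (𝓝 (T f t)) :=
  (isFiniteHilbertTransform_iff hf).1 (isFiniteHilbertTransform_T hf)

theorem T_congr {f g : ℝ → ℂ} (hf : Integrable f mu) (h : f =ᵐ[mu] g) : T f = T g := by
  refine IsFiniteHilbertTransform.T_eq ((isFiniteHilbertTransform_iff hf).2 ?_)
  filter_upwards [tendsto_truncHilbert_T (hf.congr h)] with t ht
  refine ht.congr fun ε => ?_
  congr 1
  exact integral_congr_ae (by filter_upwards [h] with x hx; simp only [hx])

theorem T_add {f g : ℝ → ℂ} (hf : Integrable f mu) (hg : Integrable g mu) :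
    T (fun x => f x + g x) = T f + T g := by
  refine IsFiniteHilbertTransform.T_eq ((isFiniteHilbertTransform_iff (hf.add hg)).2 ?_)
  filter_upwards [tendsto_truncHilbert_T hf, tendsto_truncHilbert_T hg,
    AEEqFun.coeFn_add (T f) (T g)] with t h1 h2 h3
  rw [h3]
  refine (h1.add h2).congr' ?_
  filter_upwards [self_mem_nhdsWithin] with ε hε
  exact ((congrArg _ (truncHilbert_add hf hg hε t)).trans (mul_add _ _ _)).symm

theorem T_smul {f : ℝ → ℂ} (hf : Integrable f mu) (c : ℂ) :
    T (fun x => c • f x) = c • T f := by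
  refine IsFiniteHilbertTransform.T_eq ((isFiniteHilbertTransform_iff (hf.smul c)).2 ?_)
  filter_upwards [tendsto_truncHilbert_T hf, AEEqFun.coeFn_smul c (T f)] with t h1 h3
  rw [h3]
  refine (h1.const_smul c).congr fun ε => ?_
  have : truncHilbert (fun x => c • f x) ε t = c • truncHilbert f ε t := by
    simp only [truncHilbert, smul_comm _ c]
    exact integral_smul c _
  exact ((congrArg _ this).trans (mul_smul_comm _ _ _)).symm

theorem T_zero : T (fun _ => (0 : ℂ)) = 0 := by
  have := T_smul (f := fun _ => (0 : ℂ)) (integrable_zero _ _ _) 0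
  simpa using this.trans (zero_smul ℂ (T fun _ => (0 : ℂ)))

theorem T_sub {f g : ℝ → ℂ} (hf : Integrable f mu) (hg : Integrable g mu) :
    T (fun x => f x - g x) = T f - T g := by
  have h := T_add (g := fun x => (-1 : ℂ) • g x) hf (hg.smul (-1 : ℂ))
  rw [T_smul hg, show (-1 : ℂ) • T g = -T g from neg_one_smul ℂ (T g), ← sub_eq_add_neg] at h
  rw [← h]
  simp [sub_eq_add_neg]

theorem T_finsetSum {ι : Type*} (F : Finset ι) {f : ι → ℝ → ℂ}
    (hf : ∀ i ∈ F, Integrable (f i) mu) :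
    T (fun x => ∑ i ∈ F, f i x) = ∑ i ∈ F, T (f i) := by
  classical
  induction F using Finset.induction_on with
  | empty => simpa using T_zero
  | insert i F hi ih =>
    have h1 : ∀ j ∈ F, Integrable (f j) mu := fun j hj => hf j (Finset.mem_insert_of_mem hj)
    simp only [Finset.sum_insert hi]
    rw [T_add (hf i (Finset.mem_insert_self _ _)) (integrable_finsetSum F h1), ih h1]

/-- Kolmogorov's weak type estimate for the finite Hilbert transform. -/
theorem mu_lt_norm_T_le {f : ℝ → ℂ} (hf : Integrable f mu) {c : ℝ} (hc : 0 < c) :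
    mu {t | c < ‖T f t‖} ≤ ENNReal.ofReal (1280 * (∫ x, ‖f x‖ ∂mu) / c) := by
  refine (measure_mono_ae (t := {t | ∃ ε ∈ Ioc (0 : ℝ) 1, c < ‖truncHilbert f ε t‖}) ?_).trans
    ((Measure.restrict_le_self _).trans (volume_exists_lt_norm_truncHilbert_le hf hc))
  filter_upwards [tendsto_truncHilbert_T hf] with t ht (hct : c < ‖T f t‖)
  -- A limit of norm above `c` forces some truncation with `ε ≤ 1` above `c`; the factor `1 / π`
  -- only helps.
  obtain ⟨ε, h1, h2⟩ := ((ht.norm.eventually_const_lt hct).and (Ioc_mem_nhdsGT one_pos)).exists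
  refine ⟨ε, h2, h1.trans_le ?_⟩
  rw [norm_mul]
  refine mul_le_of_le_one_left (norm_nonneg _) ?_
  rw [norm_div, norm_one, Complex.norm_real, Real.norm_of_nonneg Real.pi_pos.le]
  exact (div_le_one Real.pi_pos).2 (by linarith [Real.pi_gt_three])

/-! ### Convergence in measure and continuity of `T` -/

/-- A translation invariant gauge `∫ min(|g|, 1) dμ` for the topology of convergence in measure. -/
noncomputable def l0Gauge (g : L0) : ℝ≥0∞ := ∫⁻ x, min ‖g x‖ₑ 1 ∂mu

theorem l0Gauge_add_le (g h : L0) : l0Gauge (g + h) ≤ l0Gauge g + l0Gauge h := by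
  unfold l0Gauge
  rw [← lintegral_add_left (by fun_prop)]
  refine lintegral_mono_ae ?_
  filter_upwards [AEEqFun.coeFn_add g h] with x hx
  rw [hx, Pi.add_apply]
  refine (min_le_min_right 1 (enorm_add_le _ _)).trans ?_
  rcases le_total ‖g x‖ₑ 1 with h1 | h1
  · rcases le_total ‖h x‖ₑ 1 with h2 | h2
    · rw [min_eq_left h1, min_eq_left h2]; exact min_le_left _ _
    · rw [min_eq_right h2]; exact (min_le_right _ _).trans le_add_self
  · rw [min_eq_right h1]; exact (min_le_right _ _).trans le_self_add

theorem l0Gauge_neg (g : L0) : l0Gauge (-g) = l0Gauge g := by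
  refine lintegral_congr_ae ?_
  filter_upwards [AEEqFun.coeFn_neg g] with x hx
  rw [hx, Pi.neg_apply, enorm_neg]

theorem l0Gauge_sub_le (g h : L0) : l0Gauge (g - h) ≤ l0Gauge g + l0Gauge h := by
  rw [sub_eq_add_neg, ← l0Gauge_neg h]
  exact l0Gauge_add_le _ _

theorem l0Gauge_sub_comm (g h : L0) : l0Gauge (g - h) = l0Gauge (h - g) := by
  rw [← l0Gauge_neg, neg_sub]

theorem l0Gauge_sub_le_add (f g h : L0) :
    l0Gauge (f - h) ≤ l0Gauge (f - g) + l0Gauge (g - h) := by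
  rw [← sub_add_sub_cancel f g h]
  exact l0Gauge_add_le _ _

theorem l0Gauge_le_add_measure (g : L0) {c : ℝ} (hc : 0 < c) :
    l0Gauge g ≤ ENNReal.ofReal (2 * c) + mu {x | c < ‖g x‖} := by
  have hS : MeasurableSet {x | c < ‖g x‖} :=
    measurableSet_lt measurable_const g.measurable.norm
  calc l0Gauge g ≤ ∫⁻ x, (ENNReal.ofReal c + {x | c < ‖g x‖}.indicator (fun _ => 1) x) ∂mu := by
        refine lintegral_mono fun x => ?_
        by_cases hx : c < ‖g x‖
        · rw [indicator_of_mem (by exact hx)]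
          exact (min_le_right _ _).trans le_add_self
        · refine (min_le_left _ _).trans (le_trans ?_ le_self_add)
          rw [← ofReal_norm]
          exact ENNReal.ofReal_le_ofReal (not_lt.1 hx)
    _ = _ := by
        rw [lintegral_add_left measurable_const, lintegral_const, lintegral_indicator_const hS,
          one_mul, Measure.restrict_apply_univ, Real.volume_Ioo, ← ENNReal.ofReal_mul hc.le]
        congr 2; ring

theorem tendstoL0_iff {u : ℕ → L0} {g : L0} :
    TendstoL0 u g ↔ Tendsto (fun n => l0Gauge (u n - g)) atTop (𝓝 0) := by
  constructor
  · intro h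
    refine ENNReal.tendsto_nhds_zero.2 fun η hη => ?_
    obtain ⟨η', h0, hη'⟩ : ∃ η' : ℝ, 0 < η' ∧ ENNReal.ofReal η' ≤ η := by
      obtain ⟨r, _, h1, h2⟩ := ENNReal.lt_iff_exists_real_btwn.1 hη
      exact ⟨r, ENNReal.ofReal_pos.1 h1, h2.le⟩
    have h1 := ENNReal.tendsto_nhds_zero.1 (h (ENNReal.ofReal (η' / 4))
      (ENNReal.ofReal_pos.2 (by linarith))) (ENNReal.ofReal (η' / 2))
      (ENNReal.ofReal_pos.2 (by linarith))
    filter_upwards [h1] with n hn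
    refine (l0Gauge_le_add_measure _ (c := η' / 4) (by linarith)).trans (le_trans ?_ hη')
    calc _ ≤ ENNReal.ofReal (2 * (η' / 4)) + ENNReal.ofReal (η' / 2) := by
          gcongr
          refine le_trans (measure_mono_ae ?_) hn
          filter_upwards [AEEqFun.coeFn_sub (u n) g] with x hx (hxc : η' / 4 < ‖(u n - g) x‖)
          change ENNReal.ofReal (η' / 4) ≤ edist (u n x) (g x)
          rw [hx] at hxc
          rw [edist_eq_enorm_sub, ← ofReal_norm]
          exact ENNReal.ofReal_le_ofReal hxc.le
      _ = ENNReal.ofReal η' := by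
          rw [← ENNReal.ofReal_add (by linarith) (by linarith)]; congr 1; ring
  · intro h ε hε
    -- The gauge sees values only up to `1`, so Chebyshev's inequality is applied at the level `min
    -- ε 1`.
    have hε' : min ε 1 ≠ 0 := (lt_min hε one_pos).ne'
    have h1 : Tendsto (fun n => l0Gauge (u n - g) / min ε 1) atTop (𝓝 0) := by
      simpa using ENNReal.Tendsto.div_const h (Or.inr hε')
    refine tendsto_of_tendsto_of_tendsto_of_le_of_le tendsto_const_nhds h1 (fun _ => zero_le)
      fun n => ?_
    refine le_trans (measure_mono_ae ?_)
      (meas_ge_le_lintegral_div (by fun_prop) hε' (by simp))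
    filter_upwards [AEEqFun.coeFn_sub (u n) g] with x hx (hxc : ε ≤ edist (u n x) (g x))
    change min ε 1 ≤ min ‖(u n - g) x‖ₑ 1
    rw [hx, Pi.sub_apply, ← edist_eq_enorm_sub]
    exact min_le_min_right 1 hxc

/-- Continuity of the finite Hilbert transform from `L¹` to `L⁰`. -/
theorem exists_l0Gauge_T_le {η : ℝ≥0∞} (hη : 0 < η) :
    ∃ δ : ℝ≥0∞, 0 < δ ∧ ∀ f : ℝ → ℂ, Integrable f mu → ∫⁻ x, ‖f x‖ₑ ∂mu ≤ δ →
      l0Gauge (T f) ≤ η := by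
  obtain ⟨r, _, h1, h2⟩ := ENNReal.lt_iff_exists_real_btwn.1 hη
  have hr : 0 < r := ENNReal.ofReal_pos.1 h1
  -- At the level `c = r / 4`, both `2 * c` and `1280 * δ / c` equal `r / 2`.
  refine ⟨ENNReal.ofReal (r ^ 2 / 10240), ENNReal.ofReal_pos.2 (by positivity),
    fun f hf hle => ?_⟩
  rw [← ofReal_integral_norm_eq_lintegral_enorm hf,
    ENNReal.ofReal_le_ofReal_iff (by positivity)] at hle
  have hr4 : 0 < r / 4 := by linarith
  calc l0Gauge (T f) ≤ ENNReal.ofReal (2 * (r / 4)) +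
        ENNReal.ofReal (1280 * (r ^ 2 / 10240) / (r / 4)) :=
        (l0Gauge_le_add_measure _ hr4).trans (add_le_add le_rfl
          ((mu_lt_norm_T_le hf hr4).trans (ENNReal.ofReal_le_ofReal (by gcongr))))
    _ = ENNReal.ofReal r := by
        rw [← ENNReal.ofReal_add (by positivity) (by positivity)]
        congr 1; field_simp; ring
    _ ≤ η := h2.le

theorem tendsto_l0Gauge_T {f : ℕ → ℝ → ℂ} (hf : ∀ n, Integrable (f n) mu)
    (h : Tendsto (fun n => ∫⁻ x, ‖f n x‖ₑ ∂mu) atTop (𝓝 0)) :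
    Tendsto (fun n => l0Gauge (T (f n))) atTop (𝓝 0) := by
  refine ENNReal.tendsto_nhds_zero.2 fun η hη => ?_
  obtain ⟨δ, hδ, hT⟩ := exists_l0Gauge_T_le hη
  filter_upwards [ENNReal.tendsto_nhds_zero.1 h δ hδ] with n hn using hT _ (hf n) hn

theorem tendstoL0_T {f : ℕ → ℝ → ℂ} {g : ℝ → ℂ} (hf : ∀ n, Integrable (f n) mu)
    (hg : Integrable g mu) (h : Tendsto (fun n => ∫⁻ x, ‖f n x - g x‖ₑ ∂mu) atTop (𝓝 0)) :
    TendstoL0 (fun n => T (f n)) (T g) := by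
  refine tendstoL0_iff.2 ?_
  simp only [← T_sub (hf _) hg]
  exact tendsto_l0Gauge_T (fun n => (hf n).sub hg) h

/-! ### `σ`-additivity and integrals along `L¹` approximations -/

theorem isL0Measure_m0 : IsL0Measure m0 := by
  intro A hA hdisj
  have hint : ∀ B : Set ℝ, MeasurableSet B → Integrable (B.indicator fun _ => (1 : ℂ)) mu :=
    fun B hB => (integrable_const _).indicator hB
  have hsum : ∀ N, ∑ n ∈ Finset.range N, m0 (A n) =
      T ((⋃ n ∈ Finset.range N, A n).indicator fun _ => (1 : ℂ)) := fun N => by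
    rw [Finset.indicator_biUnion _ _ fun i _ j _ hij => hdisj hij,
      T_finsetSum _ fun n _ => hint _ (hA n)]
    rfl
  simp only [hsum]
  have hB : ∀ N, MeasurableSet (⋃ n ∈ Finset.range N, A n) := fun N =>
    Finset.measurableSet_biUnion _ fun n _ => hA n
  have hU : MeasurableSet (⋃ n, A n) := MeasurableSet.iUnion hA
  refine tendstoL0_T (fun N => hint _ (hB N)) (hint _ hU) ?_
  -- Indicators of the partial unions converge in `L¹` to that of the full union, so continuity of
  -- `T` gives `σ`-additivity.
  have hlim := tendsto_lintegral_of_dominated_convergence (μ := mu) (f := fun _ => 0)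
    (F := fun N x => ‖(⋃ n ∈ Finset.range N, A n).indicator (fun _ => (1 : ℂ)) x -
      (⋃ n, A n).indicator (fun _ => (1 : ℂ)) x‖ₑ) (fun _ => 1) (fun N => ?_) (fun N => ?_) ?_ ?_
  · simpa using hlim
  · exact ((measurable_const.indicator (hB N)).sub (measurable_const.indicator hU)).enorm
  · refine Eventually.of_forall fun x => ?_
    by_cases h1 : x ∈ ⋃ n ∈ Finset.range N, A n
    · have h2 : x ∈ ⋃ n, A n := iUnion₂_subset_iUnion _ _ h1
      simp only [indicator_of_mem h1, indicator_of_mem h2, sub_self, enorm_zero]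
      exact zero_le
    · simp only [indicator_of_notMem h1, zero_sub, enorm_neg]
      by_cases h2 : x ∈ ⋃ n, A n
      · simp [indicator_of_mem h2]
      · simp [indicator_of_notMem h2]
  · simp
  · refine Eventually.of_forall fun x => ?_
    have := (((tendsto_indicator_biUnion_finset A (fun _ => (1 : ℂ)) x).comp
      tendsto_finset_range).mono_right (pure_le_nhds _)).sub_const ((⋃ n, A n).indicator (fun _ => (1 : ℂ)) x)
    simpa using this.enorm

theorem integrable_simpleFunc (s : SimpleFunc ℝ ℂ) : Integrable s mu :=
  SimpleFunc.integrable_of_isFiniteMeasure s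

theorem simpleIntegral_m0 (s : SimpleFunc ℝ ℂ) {A : Set ℝ} (hA : MeasurableSet A) :
    simpleIntegral m0 s A = T (indicator A s) := by
  have hint : ∀ c : ℂ, Integrable ((s ⁻¹' {c} ∩ A).indicator fun _ => (1 : ℂ)) mu := fun c =>
    (integrable_const _).indicator ((s.measurableSet_preimage _).inter hA)
  have h1 : simpleIntegral m0 s A =
      ∑ c ∈ s.range, T (fun x => c • (s ⁻¹' {c} ∩ A).indicator (fun _ => (1 : ℂ)) x) :=
    Finset.sum_congr rfl fun c _ => (T_smul (hint c) c).symm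
  rw [h1, ← T_finsetSum (f := fun c x => c • (s ⁻¹' {c} ∩ A).indicator (fun _ => (1 : ℂ)) x) _
    fun c _ => (hint c).smul c]
  congr 1
  funext x
  rw [Finset.sum_eq_single (s x)]
  · by_cases hx : x ∈ A
    · rw [indicator_of_mem hx, indicator_of_mem (show x ∈ s ⁻¹' {s x} ∩ A from ⟨rfl, hx⟩), smul_eq_mul, mul_one]
    · rw [indicator_of_notMem hx, indicator_of_notMem fun h => hx h.2, smul_zero]
  · intro c _ hc
    rw [indicator_of_notMem, smul_zero]
    exact fun h => hc (mem_singleton_iff.1 (mem_preimage.1 h.1)).symm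
  · exact fun h => absurd (s.mem_range_self x) h

theorem exists_isDefiningSequence {f : ℝ → ℂ} (hfm : Measurable f) (hf : Integrable f mu) :
    ∃ s : ℕ → SimpleFunc ℝ ℂ, IsDefiningSequence m0 f s ∧ ∀ A, MeasurableSet A →
      TendstoL0 (fun n => simpleIntegral m0 (s n) A) (T (indicator A f)) := by
  set s : ℕ → SimpleFunc ℝ ℂ := fun n => SimpleFunc.approxOn f hfm univ 0 (mem_univ _) n
  have hlim : ∀ A, MeasurableSet A →
      TendstoL0 (fun n => simpleIntegral m0 (s n) A) (T (indicator A f)) := fun A hA => by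
    simp only [simpleIntegral_m0 _ hA]
    refine tendstoL0_T (fun n => (integrable_simpleFunc (s n)).indicator hA) (hf.indicator hA) ?_
    have h1 := SimpleFunc.tendsto_approxOn_L1_enorm (μ := mu) hfm (s := univ) (y₀ := 0)
      (mem_univ _) (by simp) (by simpa using hf.2)
    refine tendsto_of_tendsto_of_tendsto_of_le_of_le tendsto_const_nhds h1 (fun _ => zero_le)
      fun n => lintegral_mono fun x => ?_
    rw [← Pi.sub_apply, ← indicator_sub']
    exact enorm_indicator_le_enorm_self _ _
  exact ⟨s, ⟨fun x _ => SimpleFunc.tendsto_approxOn hfm (mem_univ _) (by simp),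
    fun A hA => ⟨_, hlim A hA⟩⟩, hlim⟩

/-! ### A Vitali–Hahn–Saks theorem -/

theorem integrable_simpleFunc_mul (d : SimpleFunc ℝ ℂ) {u : ℝ → ℂ} (hu : Integrable u mu) :
    Integrable (fun x => d x * u x) mu := by
  obtain ⟨C, hC⟩ := d.exists_forall_norm_le
  exact hu.bdd_mul d.aestronglyMeasurable (Eventually.of_forall hC)

/-- Multiplication by the bounded function `d` is continuous on `L¹`, and `T` is continuous into
`L⁰`. Closedness of these sets is what Baire's theorem needs. -/
theorem isClosed_l0Gauge_T_mul_le (d : SimpleFunc ℝ ℂ) (η : ℝ≥0∞) :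
    IsClosed {u : Lp ℂ 1 mu | l0Gauge (T fun x => d x * u x) ≤ η} := by
  refine IsSeqClosed.isClosed fun u v hu huv => ?_
  obtain ⟨C, hC⟩ := d.exists_forall_norm_le
  have hi : ∀ w : Lp ℂ 1 mu, Integrable (fun x => d x * w x) mu := fun w =>
    integrable_simpleFunc_mul d (L1.integrable_coeFn w)
  have h1 : Tendsto (fun n => ∫⁻ x, ‖d x * v x - d x * u n x‖ₑ ∂mu) atTop (𝓝 0) := by
    have h2 := (Lp.tendsto_Lp_iff_tendsto_eLpNorm' _ _).1 huv
    have h3 : Tendsto (fun n => ENNReal.ofReal C * eLpNorm (u n - v : ℝ → ℂ) 1 mu) atTop (𝓝 0) := by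
      simpa using ENNReal.Tendsto.const_mul h2 (Or.inr ENNReal.ofReal_ne_top)
    refine tendsto_of_tendsto_of_tendsto_of_le_of_le tendsto_const_nhds h3 (fun _ => zero_le)
      fun n => ?_
    change ∫⁻ x, ‖d x * v x - d x * u n x‖ₑ ∂mu ≤ _
    rw [eLpNorm_one_eq_lintegral_enorm, ← lintegral_const_mul' _ _ ENNReal.ofReal_ne_top]
    refine lintegral_mono fun x => ?_
    rw [← mul_sub, enorm_mul, ← ofReal_norm (d x), Pi.sub_apply, ← enorm_neg (v x - u n x), neg_sub]
    gcongr
    exact hC x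
  have h4 := (tendsto_l0Gauge_T (fun n => (hi v).sub (hi (u n))) h1).const_add η
  rw [add_zero] at h4
  refine ge_of_tendsto' h4 fun n => ?_
  have h5 : T (fun x => d x * v x) =
      T (fun x => d x * u n x) + T (fun x => d x * v x - d x * u n x) := by
    rw [T_sub (hi v) (hi (u n))]; abel
  rw [h5]
  exact (l0Gauge_add_le _ _).trans (add_le_add (hu n) le_rfl)

/-- The measure algebra of `(-1,1)`, as the set of indicator functions in `L¹`. -/
def indicatorSet : Set (Lp ℂ 1 mu) := {u | ∀ᵐ x ∂mu, u x ∈ ({0, 1} : Set ℂ)}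

theorem isClosed_indicatorSet : IsClosed indicatorSet := by
  refine IsSeqClosed.isClosed fun u v hu huv => ?_
  obtain ⟨ns, -, hns⟩ := (tendstoInMeasure_of_tendsto_Lp huv).exists_seq_tendsto_ae
  have hall : ∀ᵐ x ∂mu, ∀ n, u n x ∈ ({0, 1} : Set ℂ) := ae_all_iff.2 hu
  change ∀ᵐ x ∂mu, v x ∈ ({0, 1} : Set ℂ)
  filter_upwards [hns, hall] with x h1 h2
  exact (toFinite ({0, 1} : Set ℂ)).isClosed.mem_of_tendsto h1
    (Eventually.of_forall fun n => h2 (ns n))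

theorem indicatorConstLp_mem_indicatorSet {A : Set ℝ} (hA : MeasurableSet A) :
    indicatorConstLp 1 hA (measure_ne_top mu A) (1 : ℂ) ∈ indicatorSet := by
  change ∀ᵐ x ∂mu, _
  filter_upwards [indicatorConstLp_coeFn (p := 1) (hs := hA) (hμs := measure_ne_top mu A)
    (c := (1 : ℂ))] with x hx
  rw [hx]
  by_cases h : x ∈ A <;> simp [h]

theorem exists_eq_indicatorConstLp {u : Lp ℂ 1 mu} (hu : u ∈ indicatorSet) :
    ∃ (A : Set ℝ) (hA : MeasurableSet A),
      u = indicatorConstLp 1 hA (measure_ne_top mu A) (1 : ℂ) := by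
  have hA : MeasurableSet {x | u x = 1} :=
    (Lp.stronglyMeasurable u).measurable (measurableSet_singleton 1)
  refine ⟨_, hA, Lp.ext ?_⟩
  filter_upwards [indicatorConstLp_coeFn (p := 1) (hs := hA) (hμs := measure_ne_top mu _)
    (c := (1 : ℂ)), hu] with x hx h
  rw [hx]
  rcases h with h | h
  · rw [indicator_of_notMem, h]
    intro h'
    exact zero_ne_one (h.symm.trans h')
  · rw [indicator_of_mem (by exact h)]
    exact h

theorem T_mul_indicatorConstLp (d : SimpleFunc ℝ ℂ) {A : Set ℝ} (hA : MeasurableSet A) :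
    T (fun x => d x * indicatorConstLp 1 hA (measure_ne_top mu A) (1 : ℂ) x) =
      T (indicator A d) := by
  refine (T_congr ((integrable_simpleFunc d).indicator hA) ?_).symm
  filter_upwards [indicatorConstLp_coeFn (p := 1) (hs := hA) (hμs := measure_ne_top mu A)
    (c := (1 : ℂ))] with x hx
  rw [hx]
  by_cases h : x ∈ A <;> simp [h]

theorem edist_indicatorConstLp_le {A B C : Set ℝ} (hA : MeasurableSet A) (hB : MeasurableSet B)
    (hC : MeasurableSet C) (h1 : A \ C = B \ C) :
    edist (indicatorConstLp 1 hA (measure_ne_top mu A) (1 : ℂ))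
      (indicatorConstLp 1 hB (measure_ne_top mu B) (1 : ℂ)) ≤ mu C := by
  rw [Lp.edist_def, eLpNorm_one_eq_lintegral_enorm, ← lintegral_indicator_one hC]
  refine lintegral_mono_ae ?_
  filter_upwards [indicatorConstLp_coeFn (p := 1) (hs := hA) (hμs := measure_ne_top mu A)
    (c := (1 : ℂ)), indicatorConstLp_coeFn (p := 1) (hs := hB) (hμs := measure_ne_top mu B)
    (c := (1 : ℂ))] with x hx hy
  rw [Pi.sub_apply, hx, hy]
  by_cases hxC : x ∈ C
  · by_cases hxA : x ∈ A <;> by_cases hxB : x ∈ B <;> simp [hxA, hxB, hxC]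
  · have : x ∈ A ↔ x ∈ B := by
      have := Set.ext_iff.1 h1 x
      simpa [hxC] using this
    by_cases hxB : x ∈ B <;> simp [this, hxB, hxC]

theorem indicator_sub_simpleFunc (d e : SimpleFunc ℝ ℂ) {A : Set ℝ} (hA : MeasurableSet A) :
    T (indicator A (d - e : SimpleFunc ℝ ℂ)) = T (indicator A d) - T (indicator A e) := by
  rw [← T_sub ((integrable_simpleFunc d).indicator hA) ((integrable_simpleFunc e).indicator hA),
    SimpleFunc.coe_sub, indicator_sub']
  rfl

/-- Vitali–Hahn–Saks: setwise convergence of `A ↦ T (s_n χ_A)` forces uniform smallness of the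
differences on sets of small measure. -/
theorem exists_uniform_l0Gauge_le {s : ℕ → SimpleFunc ℝ ℂ}
    (hs : ∀ A, MeasurableSet A → ∃ g, TendstoL0 (fun n => T (indicator A (s n))) g)
    {η : ℝ≥0∞} (hη : 0 < η) :
    ∃ k, ∃ δ > 0, ∀ A, MeasurableSet A → mu A < δ → ∀ n ≥ k,
      l0Gauge (T (indicator A (s n)) - T (indicator A (s k))) ≤ η := by
  -- `F k` collects the sets over which the integrals from index `k` on differ by at most `η / 2`.
  -- Setwise convergence makes the `F k` cover the whole measure algebra.
  set F : ℕ → Set indicatorSet := fun k => ⋂ n ≥ k, ⋂ m ≥ k,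
    Subtype.val ⁻¹' {u : Lp ℂ 1 mu | l0Gauge (T fun x => (s n - s m) x * u x) ≤ η / 2} with hF
  have hη2 : 0 < η / 2 := ENNReal.half_pos hη.ne'
  have hη4 : 0 < η / 2 / 2 := ENNReal.half_pos hη2.ne'
  have hclosed : ∀ k, IsClosed (F k) := fun k => by
    refine isClosed_iInter fun n => isClosed_iInter fun _ => isClosed_iInter fun m =>
      isClosed_iInter fun _ => ?_
    exact (isClosed_l0Gauge_T_mul_le (s n - s m) (η / 2)).preimage continuous_subtype_val
  have hunion : ⋃ k, F k = univ := by
    refine eq_univ_of_forall fun ⟨u, hu⟩ => ?_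
    obtain ⟨A, hA, rfl⟩ := exists_eq_indicatorConstLp hu
    obtain ⟨g, hg⟩ := hs A hA
    obtain ⟨k, hk⟩ := eventually_atTop.1
      (ENNReal.tendsto_nhds_zero.1 (tendstoL0_iff.1 hg) _ hη4)
    refine mem_iUnion.2 ⟨k, ?_⟩
    simp only [hF, mem_iInter, mem_preimage, mem_ofPred_eq]
    intro n hn m hm
    rw [T_mul_indicatorConstLp, indicator_sub_simpleFunc _ _ hA]
    refine (l0Gauge_sub_le_add _ g _).trans ?_
    rw [l0Gauge_sub_comm g, ← ENNReal.add_halves (η / 2)]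
    exact add_le_add (hk n hn) (hk m hm)
  have : CompleteSpace indicatorSet := isClosed_indicatorSet.completeSpace_coe
  have : Nonempty indicatorSet := ⟨_, indicatorConstLp_mem_indicatorSet MeasurableSet.empty⟩
  -- Baire: some `F k` contains a ball around a set `B`. For `A` of measure below its radius, `B ∪
  -- A` and `B \ A` stay in the ball, and `χ_A` is the difference of their indicators.
  obtain ⟨k, ⟨u, hu⟩, hint⟩ := nonempty_interior_of_iUnion_of_closed hclosed hunion
  obtain ⟨B, hB, rfl⟩ := exists_eq_indicatorConstLp hu
  obtain ⟨δ, hδ, hball⟩ := EMetric.mem_nhds_iff.1 (mem_interior_iff_mem_nhds.1 hint)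
  refine ⟨k, δ, hδ, fun A hA hAδ n hn => ?_⟩
  have key : ∀ D (hD : MeasurableSet D), D \ A = B \ A →
      l0Gauge (T (indicator D (s n - s k : SimpleFunc ℝ ℂ))) ≤ η / 2 := fun D hD hDA => by
    have hmem : (⟨_, indicatorConstLp_mem_indicatorSet hD⟩ : indicatorSet) ∈ F k :=
      hball (Metric.mem_eball.2 ((edist_indicatorConstLp_le hD hB hA hDA).trans_lt hAδ))
    simp only [hF, mem_iInter, mem_preimage, mem_ofPred_eq] at hmem
    have := hmem n hn k le_rfl
    rwa [T_mul_indicatorConstLp] at this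
  have h1 := key (B ∪ A) (hB.union hA) (by ext x; simp)
  have h2 := key (B \ A) (hB.diff hA) (by ext x; simp)
  have h3 : T (indicator A (s n)) - T (indicator A (s k)) =
      T (indicator (B ∪ A) (s n - s k : SimpleFunc ℝ ℂ)) -
        T (indicator (B \ A) (s n - s k : SimpleFunc ℝ ℂ)) := by
    rw [← indicator_sub_simpleFunc _ _ hA,
      ← T_sub ((integrable_simpleFunc _).indicator (hB.union hA))
        ((integrable_simpleFunc _).indicator (hB.diff hA))]
    congr 1
    funext x
    by_cases hxA : x ∈ A <;> by_cases hxB : x ∈ B <;> simp [hxA, hxB]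
  rw [h3, ← ENNReal.add_halves η]
  exact (l0Gauge_sub_le _ _).trans (add_le_add h1 h2)

/-! ### Independence of the defining sequence -/

theorem exists_l0Gauge_T_indicator_le {f : ℝ → ℂ} (hf : Integrable f mu) {η : ℝ≥0∞} (hη : 0 < η) :
    ∃ δ > 0, ∀ A, MeasurableSet A → mu A < δ → l0Gauge (T (indicator A f)) ≤ η := by
  obtain ⟨d, hd, hT⟩ := exists_l0Gauge_T_le hη
  obtain ⟨δ, hδ, h⟩ := exists_pos_setLIntegral_lt_of_measure_lt (μ := mu)
    (f := fun x => ‖f x‖ₑ) hf.2.ne hd.ne'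
  refine ⟨δ, hδ, fun A hA hAδ => hT _ (hf.indicator hA) ?_⟩
  have : ∀ x, ‖indicator A f x‖ₑ = indicator A (fun x => ‖f x‖ₑ) x := fun x =>
    enorm_indicator_eq_indicator_enorm _ _
  simp only [this]
  rw [lintegral_indicator hA]
  exact (h A hAδ).le

theorem T_indicator_inter_add_diff {f : ℝ → ℂ} (hf : Integrable f mu) {A B : Set ℝ}
    (hA : MeasurableSet A) (hB : MeasurableSet B) :
    T (indicator A f) = T (indicator (A ∩ B) f) + T (indicator (A \ B) f) := by
  rw [← T_add (hf.indicator (hA.inter hB)) (hf.indicator (hA.diff hB))]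
  congr 1
  funext x
  by_cases hxA : x ∈ A <;> by_cases hxB : x ∈ B <;> simp [hxA, hxB]

/-- The integral of an integrable function does not depend on the defining sequence. -/
theorem IsDefiningSequence.tendstoL0 {f : ℝ → ℂ} (hfm : Measurable f) (hf : Integrable f mu)
    {s : ℕ → SimpleFunc ℝ ℂ} (h : IsDefiningSequence m0 f s) {A : Set ℝ} (hA : MeasurableSet A) :
    TendstoL0 (fun n => simpleIntegral m0 (s n) A) (T (indicator A f)) := by
  have hs : ∀ A, MeasurableSet A → ∃ g, TendstoL0 (fun n => T (indicator A (s n))) g :=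
    fun A hA => by simpa only [simpleIntegral_m0 _ hA] using h.2 A hA
  simp only [simpleIntegral_m0 _ hA]
  refine tendstoL0_iff.2 (ENNReal.tendsto_nhds_zero.2 fun η hη => ?_)
  have hη2 : 0 < η / 2 := ENNReal.half_pos hη.ne'
  have hη4 : 0 < η / 2 / 2 := ENNReal.half_pos hη2.ne'
  obtain ⟨k, δ₁, hδ₁, h₁⟩ := exists_uniform_l0Gauge_le hs hη4
  obtain ⟨δ₂, hδ₂, h₂⟩ := exists_l0Gauge_T_indicator_le
    ((integrable_simpleFunc (s k)).sub hf) hη4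
  obtain ⟨r, -, hr0, hr⟩ := ENNReal.lt_iff_exists_real_btwn.1 (lt_min hδ₁ hδ₂)
  -- Egorov: convergence is uniform off a set `B` so small that both estimates for sets of small
  -- measure apply to `A ∩ B`. There `s n` is compared with the fixed `s k`, and `s k` with `f`; on
  -- `A \ B` uniform convergence gives closeness in `L¹`.
  obtain ⟨B, hB, hBr, hunif⟩ := tendstoUniformlyOn_of_ae_tendsto' (μ := mu)
    (fun n => (s n).stronglyMeasurable) hfm.stronglyMeasurable
    (by filter_upwards [ae_restrict_mem measurableSet_Ioo] with x hx using h.1 x hx)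
    (ENNReal.ofReal_pos.1 hr0)
  have hAB : mu (A ∩ B) < min δ₁ δ₂ := ((measure_mono inter_subset_right).trans hBr).trans_lt hr
  have hABm : MeasurableSet (A ∩ B) := hA.inter hB
  obtain ⟨d, hd, hT⟩ := exists_l0Gauge_T_le hη2
  obtain ⟨c, hc0, hcd⟩ : ∃ c : ℝ, 0 < c ∧ ENNReal.ofReal c * 2 ≤ d := by
    obtain ⟨c, _, h1, h2⟩ := ENNReal.lt_iff_exists_real_btwn.1 (ENNReal.half_pos hd.ne')
    refine ⟨c, ENNReal.ofReal_pos.1 h1, ?_⟩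
    exact (mul_le_mul_left h2.le 2).trans_eq (ENNReal.div_mul_cancel (by simp) (by simp))
  filter_upwards [eventually_ge_atTop k, Metric.tendstoUniformlyOn_iff.1 hunif c hc0]
    with n hn hnc
  have hsn := integrable_simpleFunc (s n)
  have e1 : l0Gauge (T (indicator (A \ B) (s n)) - T (indicator (A \ B) f)) ≤ η / 2 := by
    rw [← T_sub (hsn.indicator (hA.diff hB)) (hf.indicator (hA.diff hB))]
    refine hT _ ((hsn.indicator (hA.diff hB)).sub (hf.indicator (hA.diff hB))) (le_trans ?_ hcd)
    calc _ ≤ ∫⁻ _, ENNReal.ofReal c ∂mu := by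
          refine lintegral_mono fun x => ?_
          change ‖_‖ₑ ≤ _
          by_cases hx : x ∈ A \ B
          · rw [indicator_of_mem hx, indicator_of_mem hx, ← ofReal_norm, ← dist_eq_norm, dist_comm]
            exact ENNReal.ofReal_le_ofReal (hnc x hx.2).le
          · rw [indicator_of_notMem hx, indicator_of_notMem hx, sub_self, enorm_zero]
            exact zero_le
      _ = ENNReal.ofReal c * 2 := by
          rw [lintegral_const, Measure.restrict_apply_univ, Real.volume_Ioo]
          norm_num
  have e2 := h₁ _ hABm (hAB.trans_le (min_le_left _ _)) n hn
  have e3 := h₂ _ hABm (hAB.trans_le (min_le_right _ _))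
  rw [indicator_sub'] at e3
  have e3' : l0Gauge (T (indicator (A ∩ B) (s k)) - T (indicator (A ∩ B) f)) ≤ η / 2 / 2 := by
    rw [← T_sub ((integrable_simpleFunc (s k)).indicator hABm) (hf.indicator hABm)]
    exact e3
  rw [T_indicator_inter_add_diff hsn hA hB, T_indicator_inter_add_diff hf hA hB, add_sub_add_comm]
  calc _ ≤ _ := l0Gauge_add_le _ _
    _ ≤ (η / 2 / 2 + η / 2 / 2) + η / 2 :=
      add_le_add ((l0Gauge_sub_le_add _ _ _).trans (add_le_add e2 e3')) e1
    _ = η := by rw [ENNReal.add_halves, ENNReal.add_halves]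

theorem TendstoL0.unique {u : ℕ → L0} {g h : L0} (hg : TendstoL0 u g) (hh : TendstoL0 u h) :
    g = h :=
  AEEqFun.ext (tendstoInMeasure_ae_unique hg hh)

theorem HasIntegral.eq_T {f : ℝ → ℂ} (hfm : Measurable f) (hf : Integrable f mu) {A : Set ℝ}
    (hA : MeasurableSet A) {g : L0} (h : HasIntegral m0 f A g) : g = T (indicator A f) := by
  obtain ⟨s, hs, hg⟩ := h
  exact hg.unique (hs.tendstoL0 hfm hf hA)

theorem integral_m0 {f : ℝ → ℂ} (hfm : Measurable f) (hf : Integrable f mu) {A : Set ℝ}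
    (hA : MeasurableSet A) : integral m0 f A = T (indicator A f) := by
  obtain ⟨s, hs, hlim⟩ := exists_isDefiningSequence hfm hf
  have hex : ∃ g, HasIntegral m0 f A g := ⟨_, s, hs, hlim A hA⟩
  rw [integral, dif_pos hex]
  exact hex.choose_spec.eq_T hfm hf hA

theorem integral_m0_Ioo {f : ℝ → ℂ} (hfm : Measurable f) (hf : Integrable f mu) :
    integral m0 f (Ioo (-1) 1) = T f := by
  rw [integral_m0 hfm hf measurableSet_Ioo]
  refine (T_congr hf ?_).symm
  filter_upwards [ae_restrict_mem measurableSet_Ioo] with x hx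
  rw [indicator_of_mem hx]

/-! ### The linear space `[T,X]` -/

theorem T_mem_of_ae_norm_le {X : BanachFunctionSpace} {f : L0} (hf : f ∈ optimalDomain X)
    {h : ℝ → ℂ} (hm : AEStronglyMeasurable h mu) (hle : ∀ᵐ x ∂mu, ‖h x‖ ≤ ‖f x‖) :
    T h ∈ X.carrier := by
  have hae := AEEqFun.coeFn_mk h hm
  rw [T_congr (hf.1.mono hm hle) hae.symm]
  refine hf.2 _ ?_
  filter_upwards [hae, hle] with x h1 h2
  rwa [h1]

theorem add_mem_optimalDomain {X : BanachFunctionSpace} {f g : L0} (hf : f ∈ optimalDomain X)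
    (hg : g ∈ optimalDomain X) : f + g ∈ optimalDomain X := by
  have hadd := AEEqFun.coeFn_add f g
  have hi : Integrable (f + g : L0) mu := (hf.1.add hg.1).congr hadd.symm
  refine ⟨hi, fun h hle => ?_⟩
  -- `h` is split as `w |f| + w |g|` with `|w| ≤ 1`, so that each summand is dominated by `|f|` or
  -- `|g|` alone.
  set w : ℝ → ℂ := fun x => h x * ((‖f x‖ + ‖g x‖ : ℝ) : ℂ)⁻¹ with hw
  have hwm : Measurable w := h.measurable.mul
    (Complex.measurable_ofReal.comp (f.measurable.norm.add g.measurable.norm)).inv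
  have hwle : ∀ᵐ x ∂mu, ‖w x‖ ≤ 1 ∧ h x = w x * (‖f x‖ : ℂ) + w x * (‖g x‖ : ℂ) := by
    filter_upwards [hadd, hle] with x h1 h2
    have h3 : ‖h x‖ ≤ ‖f x‖ + ‖g x‖ := h2.trans (by rw [h1]; exact norm_add_le _ _)
    have h0 : 0 ≤ ‖f x‖ + ‖g x‖ := by positivity
    refine ⟨?_, ?_⟩
    · rw [hw]
      simp only [norm_mul, norm_inv, Complex.norm_real, Real.norm_of_nonneg h0]
      exact (div_eq_mul_inv _ _).symm.trans_le (div_le_one_of_le₀ h3 h0)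
    · rw [← mul_add, ← Complex.ofReal_add, hw]
      -- Where `|f| + |g| = 0` the inverse in `w` is `0` by convention, and `h` vanishes as well.
      rcases h0.eq_or_lt with h4 | h4
      · rw [← h4] at h3 ⊢
        simp [norm_le_zero_iff.1 h3]
      · have : ((‖f x‖ + ‖g x‖ : ℝ) : ℂ) ≠ 0 := Complex.ofReal_ne_zero.2 h4.ne'
        simp only
        rw [mul_assoc, inv_mul_cancel₀ this, mul_one]
  have hpart : ∀ k : L0, k ∈ optimalDomain X →
      Integrable (fun x => w x * (‖k x‖ : ℂ)) mu ∧ T (fun x => w x * (‖k x‖ : ℂ)) ∈ X.carrier := by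
    intro k hk
    have hm : AEStronglyMeasurable (fun x => w x * (‖k x‖ : ℂ)) mu :=
      (hwm.mul (Complex.measurable_ofReal.comp k.measurable.norm)).aestronglyMeasurable
    have hb : ∀ᵐ x ∂mu, ‖w x * (‖k x‖ : ℂ)‖ ≤ ‖k x‖ := by
      filter_upwards [hwle] with x hx
      rw [norm_mul, Complex.norm_real, norm_norm]
      exact mul_le_of_le_one_left (norm_nonneg _) hx.1
    exact ⟨hk.1.mono hm hb, T_mem_of_ae_norm_le hk hm hb⟩
  obtain ⟨i1, m1⟩ := hpart f hf
  obtain ⟨i2, m2⟩ := hpart g hg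
  rw [T_congr (hi.mono h.aestronglyMeasurable hle) (hwle.mono fun x hx => hx.2), T_add i1 i2]
  exact X.carrier.add_mem m1 m2

theorem smul_mem_optimalDomain {X : BanachFunctionSpace} (c : ℂ) {f : L0}
    (hf : f ∈ optimalDomain X) : c • f ∈ optimalDomain X := by
  have hsm := AEEqFun.coeFn_smul c f
  have hi : Integrable (c • f : L0) mu := (hf.1.smul c).congr hsm.symm
  refine ⟨hi, fun h hle => ?_⟩
  have hhi : Integrable h mu := hi.mono h.aestronglyMeasurable hle
  have hle' : ∀ᵐ x ∂mu, ‖h x‖ ≤ ‖c‖ * ‖f x‖ := by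
    filter_upwards [hle, hsm] with x h1 h2
    rwa [h2, Pi.smul_apply, norm_smul] at h1
  by_cases hc : c = 0
  · have : h =ᵐ[mu] fun _ => 0 := by
      filter_upwards [hle'] with x hx
      simpa [hc] using hx
    rw [T_congr hhi this, T_zero]
    exact X.carrier.zero_mem
  · have hd : T (fun x => c⁻¹ • h x) ∈ X.carrier := by
      refine T_mem_of_ae_norm_le hf (h.aestronglyMeasurable.const_smul c⁻¹) ?_
      -- Dividing by `c` brings `h` under the bound `|f|`; `T` then restores the factor `c` by
      -- homogeneity.
      filter_upwards [hle'] with x hx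
      rw [norm_smul, norm_inv]
      exact inv_mul_le_of_le_mul₀ (norm_nonneg c) (norm_nonneg _) hx
    have := T_smul (hhi.smul c⁻¹) c
    simp only [Pi.smul_apply, smul_inv_smul₀ hc] at this
    rw [this]
    exact X.carrier.smul_mem c hd

/-- The space `[T,X]` as a linear subspace of `L⁰`. -/
noncomputable def optimalDomainSubmodule (X : BanachFunctionSpace) : Submodule ℂ L0 where
  carrier := optimalDomain X
  add_mem' := add_mem_optimalDomain
  zero_mem' := by
    have h0 : ((0 : L0) : ℝ → ℂ) =ᵐ[mu] fun _ => 0 := AEEqFun.coeFn_zero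
    refine ⟨(integrable_zero ℝ ℂ mu).congr h0.symm, fun h hle => ?_⟩
    have : h =ᵐ[mu] fun _ => 0 := by
      filter_upwards [hle, h0] with x h1 h2
      rw [h2, norm_zero] at h1
      exact norm_le_zero_iff.1 h1
    rw [T_congr ((integrable_zero ℝ ℂ mu).congr this.symm) this, T_zero]
    exact X.carrier.zero_mem
  smul_mem' := fun c _ => smul_mem_optimalDomain c

/-- The finite Hilbert transform as a linear operator `[T,X] → X`. -/
noncomputable def optimalDomainT (X : BanachFunctionSpace) :
    optimalDomainSubmodule X →ₗ[ℂ] X.carrier where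
  toFun f := ⟨T (f : L0), f.2.2 _ (Eventually.of_forall fun _ => le_rfl)⟩
  map_add' f g := Subtype.ext <|
    (T_congr (f + g).2.1 (AEEqFun.coeFn_add (f : L0) (g : L0))).trans (T_add f.2.1 g.2.1)
  map_smul' c f := Subtype.ext <|
    (T_congr (c • f).2.1 (AEEqFun.coeFn_smul c (f : L0))).trans (T_smul f.2.1 c)

end FHT

/-- `m0` is the vector measure `A ↦ T χ_A` regarded as `L⁰`-valued. The first two conjuncts say that
`T` is defined on all of `L¹` and that `m0` is `σ`-additive. In the last one, `S` is `T` as a linear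
operator from `[T,X]` to `X`. -/
theorem proposition4p4 (X : FHT.BanachFunctionSpace) (hX : X.IsRearrangementInvariant)
    (hlow : 0 < X.lowerBoyd) (hle : X.lowerBoyd ≤ X.upperBoyd) (hup : X.upperBoyd < 1) :
    (∀ f : ℝ → ℂ, Integrable f FHT.mu → FHT.IsFiniteHilbertTransform f (FHT.T f)) ∧
    FHT.IsL0Measure FHT.m0 ∧
    (∀ f : ℝ → ℂ, Measurable f → Integrable f FHT.mu →
      FHT.IsIntegrable FHT.m0 f ∧
      ∀ A : Set ℝ, MeasurableSet A →
        (∀ g : FHT.L0, FHT.HasIntegral FHT.m0 f A g → g = FHT.T (indicator A f)) ∧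
        FHT.integral FHT.m0 f A = FHT.T (indicator A f)) ∧
    (∀ (f : ℝ → ℂ) (hf : Measurable f),
      (AEEqFun.mk f hf.aestronglyMeasurable : FHT.L0) ∈ FHT.optimalDomain X →
      (∀ A : Set ℝ, MeasurableSet A → FHT.integral FHT.m0 f A ∈ X.carrier) ∧
      FHT.T f ∈ X.carrier ∧
      FHT.T f = FHT.integral FHT.m0 f (Ioo (-1) 1)) ∧
    ∃ (V : Submodule ℂ FHT.L0) (S : V →ₗ[ℂ] X.carrier), (V : Set FHT.L0) = FHT.optimalDomain X ∧
      ∀ f : V, ((S f : X.carrier) : FHT.L0) = FHT.T (f : FHT.L0) ∧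
        ((S f : X.carrier) : FHT.L0) = FHT.integral FHT.m0 (f : FHT.L0) (Ioo (-1) 1) := by
  refine ⟨fun f hf => FHT.isFiniteHilbertTransform_T hf, FHT.isL0Measure_m0,
    fun f hfm hf => ⟨?_, fun A hA => ⟨fun g hg => hg.eq_T hfm hf hA, FHT.integral_m0 hfm hf hA⟩⟩,
    fun f hfm hfX => ?_, FHT.optimalDomainSubmodule X, FHT.optimalDomainT X, rfl,
    fun f => ⟨rfl, (FHT.integral_m0_Ioo (f : FHT.L0).measurable f.2.1).symm⟩⟩
  · obtain ⟨s, hs, -⟩ := FHT.exists_isDefiningSequence hfm hf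
    exact ⟨s, hs⟩
  · have hae := AEEqFun.coeFn_mk (μ := FHT.mu) f hfm.aestronglyMeasurable
    have hf : Integrable f FHT.mu := hfX.1.congr hae
    refine ⟨fun A hA => ?_, ?_, (FHT.integral_m0_Ioo hfm hf).symm⟩
    · rw [FHT.integral_m0 hfm hf hA]
      refine FHT.T_mem_of_ae_norm_le hfX (hf.indicator hA).aestronglyMeasurable ?_
      filter_upwards [hae] with x hx
      rw [hx]
      exact norm_indicator_le_norm_self _ _
    · exact FHT.T_mem_of_ae_norm_le hfX hfm.aestronglyMeasurable
        (hae.mono fun x hx => (congrArg norm hx).ge)
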